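/- Let $\mathbb R^+=[0,\infty)$, let $H^1_0(\mathbb R^+)=\{\psi\in H^1(\mathbb R^+):\psi(0)=0\}$ (real-valued functions, identified with their continuous representatives) and $S_\infty=\{\psi\in H^1_0(\mathbb R^+):\int_0^\infty\psi^2=1\}$. For a real potential $U$ put $$J_U(\psi)=\int_0^\infty|\psi'|^2\,d\xi+\int_0^\infty U\psi^2\,d\xi,\qquad E_1^\infty[U]=\inf_{\psi\in S_\infty}J_U(\psi).$$ A *potential* is a function $U\in L^1_{loc}$ on the half-line with $U\ge 0$ a.e. (integrability is only required on compact subsets of $(0,\infty)$). Upper and lower limits and limits at $+\infty$ of such functions are essential ones (up to null sets). $L_0^\infty(\mathbb R^+)$ is the space of bounded measurable functions on $\mathbb R^+$ with compact support in $[0,\infty)$. We write $\frac{dE_1^\infty}{dU}[U].W=d$ if $E_1^\infty[U+tW]$ is finite for all real $t$ near $0$ and $t\mapsto E_1^\infty[U+tW]$ is differentiable at $t=0$ with derivative $d$ (Gâteaux derivative). **Proposition 3.1.** 1. For every potential $U$ one has $0\le E_1^\infty[U]<\infty$. On the convex set of potentials the map $U\mapsto E_1^\infty[U]$ is - continuous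 with respect to the uniformly local $L^1$ distance $\sup_{a\ge0}\int_a^{a+1}|U-V|\,d\xi$ (hence also with respect to the distance $\|U-V\|_{L^p(\mathbb R^+)}$ for each $1\le p\le\infty$), - concave, - increasing, in the sense that $U\le V$ a.e. implies $E_1^\infty[U]\le E_1^\infty[V]$, and it satisfies $E_1^\infty[U]\le\limsup_{\xi\to+\infty}U(\xi)$. 2. If $U$ is a potential with $E_1^\infty[U]<\liminf_{\xi\to+\infty}U(\xi)$, then there is $\psi_1[U]\in S_\infty$ with $\psi_1[U]>0$ on $(0,\infty)$ and $J_U(\psi_1[U])=E_1^\infty[U]$, and $\psi_1[U]$ is the only nonnegative function in $S_\infty$ at which $J_U$ takes the value $E_1^\infty[U]$. Moreover, for every $W\in L_0^\infty(\mathbb R^+)$, $$\frac{dE_1^\infty}{dU}[U].W=\int_0^\infty|\psi_1[U]|^2\,W\,d\xi .$$ 3. If $U$ is a potential such that $\lim_{\xi\to+\infty}U(\xi)$ exists, $U\le\lim_{\xi\to+\infty}U(\xi)$ a.e., and $E_1^\infty[U]=\lim_{\xi\to+\infty}U(\xi)$, then $\frac{dE_1^\infty}{dU}[U].W=0$ for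 every $W\in L_0^\infty(\mathbb R^+)$. 4. For every constant $\alpha>0$, $E_1^\infty[\alpha\sqrt\xi]=\alpha^{4/5}E_1^\infty[\sqrt\xi]$. -/

import Mathlib

open MeasureTheory Set Filter Topology
open scoped ENNReal ContDiff

noncomputable section

namespace HalfLine

/-- Lebesgue measure on the half-line `(0, ∞)`. -/
abbrev halfVolume : Measure ℝ := volume.restrict (Ioi 0)

/-- `g` is a weak derivative of `ψ` on `(0, ∞)`, tested against `C_c^∞((0, ∞))`. -/
def IsWeakDeriv (ψ g : ℝ → ℝ) : Prop :=
  ∀ φ : ℝ → ℝ, ContDiff ℝ ∞ φ → HasCompactSupport φ → tsupport φ ⊆ Ioi 0 →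
    ∫ ξ in Ioi 0, ψ ξ * deriv φ ξ = -∫ ξ in Ioi 0, g ξ * φ ξ

open Classical in
/-- The weak derivative of `ψ` on `(0, ∞)` (`0` if there is no locally integrable one).
It is determined up to a null set, see `IsWeakDeriv.ae_eq`. -/
def weakDeriv (ψ : ℝ → ℝ) : ℝ → ℝ :=
  if h : ∃ g : ℝ → ℝ, LocallyIntegrableOn g (Ioi 0) ∧ IsWeakDeriv ψ g then h.choose else 0

/-- The space `H^1_0(ℝ⁺)` of square integrable functions on the half-line with square integrable
weak derivative and value `0` at `0`. A member is given by its continuous representative on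
`[0, ∞)`; the values of `ψ` on the negative half-line are irrelevant. -/
structure MemH10 (ψ : ℝ → ℝ) : Prop where
  continuousOn : ContinuousOn ψ (Ici 0)
  map_zero : ψ 0 = 0
  memLp : MemLp ψ 2 halfVolume
  exists_weakDeriv : ∃ g : ℝ → ℝ, MemLp g 2 halfVolume ∧ IsWeakDeriv ψ g

/-- The `L²`-normalized functions of `H^1_0(ℝ⁺)`. -/
def unitSphere : Set (ℝ → ℝ) :=
  {ψ | MemH10 ψ ∧ ∫ ξ in Ioi 0, ψ ξ ^ 2 = 1}

/-- The energy `∫ |ψ'|² + ∫ U ψ²` on the half-line, as an extended real number. The last integral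
is written as the difference of the integrals of its positive and negative parts; the
latter is zero for `U ≥ 0`, and finite whenever `U` is bounded below and `ψ ∈ L²`. -/
def energy (U ψ : ℝ → ℝ) : EReal :=
  (((∫⁻ ξ in Ioi 0, ENNReal.ofReal (weakDeriv ψ ξ ^ 2)) +
      ∫⁻ ξ in Ioi 0, ENNReal.ofReal (U ξ * ψ ξ ^ 2) : ℝ≥0∞) : EReal) -
    ((∫⁻ ξ in Ioi 0, ENNReal.ofReal (-(U ξ * ψ ξ ^ 2)) : ℝ≥0∞) : EReal)

/-- The fundamental mode of the Dirichlet operator `-d²/dξ² + U` on the half-line. -/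
def fundamentalMode (U : ℝ → ℝ) : EReal :=
  ⨅ ψ ∈ unitSphere, energy U ψ

/-- Nonnegative potentials in `L¹_loc(ℝ⁺)`. Integrability is only required on the compact subsets
of the open half-line, so that every potential in `L¹_loc([0, ∞))` is included. -/
structure IsPotential (U : ℝ → ℝ) : Prop where
  locallyIntegrableOn : LocallyIntegrableOn U (Ioi 0)
  nonneg : ∀ᵐ ξ ∂halfVolume, 0 ≤ U ξ

/-- The space `L^∞_0(ℝ⁺)` of bounded measurable functions with compact support in `[0, ∞)`. -/
structure IsBoundedCompact (W : ℝ → ℝ) : Prop where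
  aestronglyMeasurable : AEStronglyMeasurable W halfVolume
  bounded : ∃ C : ℝ, ∀ᵐ ξ ∂halfVolume, |W ξ| ≤ C
  compact_support : ∃ R : ℝ, ∀ᵐ ξ ∂halfVolume, R < ξ → W ξ = 0

/-- Neighbourhoods of `+∞` up to null sets: limits along this filter are essential limits, as is
appropriate for functions that are defined almost everywhere. -/
abbrev essAtTop : Filter ℝ := atTop ⊓ ae volume

/-- The uniformly local `L¹` distance `sup_{a ≥ 0} ∫_a^{a+1} |U - V|`. It is at most the
`L^p(ℝ⁺)` distance for every `1 ≤ p ≤ ∞`. -/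
def ulocDist (U V : ℝ → ℝ) : ℝ≥0∞ :=
  ⨆ a ∈ Ici (0 : ℝ), ∫⁻ ξ in Ioc a (a + 1), ENNReal.ofReal |U ξ - V ξ|

/-- `d` is the (two-sided) Gâteaux derivative at `U` in the direction `W` of the extended real
valued functional `F`, which is required to be finite along the line near `U`. -/
def HasGateauxDeriv (F : (ℝ → ℝ) → EReal) (U W : ℝ → ℝ) (d : ℝ) : Prop :=
  (∀ᶠ t : ℝ in 𝓝 0, F (fun ξ => U ξ + t * W ξ) ≠ ⊤ ∧ F (fun ξ => U ξ + t * W ξ) ≠ ⊥) ∧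
    HasDerivAt (fun t : ℝ => (F (fun ξ => U ξ + t * W ξ)).toReal) d 0

/-- Locally integrable weak derivatives are unique up to a null set. -/
theorem IsWeakDeriv.ae_eq {ψ g₁ g₂ : ℝ → ℝ} (h₁ : IsWeakDeriv ψ g₁) (h₂ : IsWeakDeriv ψ g₂)
    (hg₁ : LocallyIntegrableOn g₁ (Ioi 0)) (hg₂ : LocallyIntegrableOn g₂ (Ioi 0)) :
    g₁ =ᵐ[halfVolume] g₂ := by
  have key := isOpen_Ioi.ae_eq_zero_of_integral_contDiff_smul_eq_zero (μ := volume)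
    (hg₁.sub hg₂) (fun φ hφ hc hs => by
      have hz : ∀ g : ℝ → ℝ, ∫ x, φ x * g x = ∫ x in Ioi 0, g x * φ x := by
        intro g
        rw [setIntegral_eq_integral_of_forall_compl_eq_zero]
        · exact integral_congr_ae (Eventually.of_forall fun x => mul_comm _ _)
        · intro x hx
          rw [image_eq_zero_of_notMem_tsupport (fun h => hx (hs h)), mul_zero]
      have hint : ∀ g : ℝ → ℝ, LocallyIntegrableOn g (Ioi 0) →
          Integrable (fun x => φ x * g x) := by
        intro g hg
        have h1 : IntegrableOn g (tsupport φ) := hg.integrableOn_compact_subset hs hc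
        have h2 : IntegrableOn (fun x => φ x * g x) (tsupport φ) :=
          h1.continuousOn_mul hφ.continuous.continuousOn hc
        refine (integrableOn_iff_integrable_of_support_subset ?_).1 h2
        intro x hx
        by_contra h
        exact hx (by simp [image_eq_zero_of_notMem_tsupport h])
      have e : ∫ x, φ x • (g₁ - g₂) x = (∫ x, φ x * g₁ x) - ∫ x, φ x * g₂ x := by
        rw [← integral_sub (hint g₁ hg₁) (hint g₂ hg₂)]
        simp [mul_sub]
      rw [e, hz, hz]
      have a₁ := h₁ φ hφ hc hs
      have a₂ := h₂ φ hφ hc hs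
      linarith)
  rw [Filter.EventuallyEq, ae_restrict_iff' measurableSet_Ioi]
  filter_upwards [key] with x hx hx0
  exact sub_eq_zero.1 (hx hx0)

/-- On `H^1_0(ℝ⁺)` the function `weakDeriv ψ` agrees with any weak derivative in `L²`. -/
theorem weakDeriv_ae_eq {ψ g : ℝ → ℝ} (hg : MemLp g 2 halfVolume) (h : IsWeakDeriv ψ g) :
    weakDeriv ψ =ᵐ[halfVolume] g := by
  have hl : LocallyIntegrableOn g (Ioi 0) :=
    locallyIntegrableOn_of_locallyIntegrable_restrict (hg.locallyIntegrable (by norm_num))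
  have hex : ∃ g : ℝ → ℝ, LocallyIntegrableOn g (Ioi 0) ∧ IsWeakDeriv ψ g := ⟨g, hl, h⟩
  rw [weakDeriv, dif_pos hex]
  exact hex.choose_spec.2.ae_eq h hex.choose_spec.1 hl

end HalfLine

end

noncomputable section

namespace HalfLine

/-! Everything is reduced to a calculus of pairs `IsH1 f g`, in which `f` is the primitive of `g`
from 0 and both are square integrable; `MemH10.isH1` shows that each function in the sphere is of
this kind. For potentials bounded below, `IsAdmissible.toReal_mul_le` and `IsAdmissible.le_toReal`
turn the extended real infimum into ordinary real inequalities.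

The energy is affine in the potential, so its infimum is concave, and monotonicity is immediate.
Continuity is a form bound: on each unit interval `f²` is controlled by the local `H¹` norm, so a
small uniformly local perturbation costs a small multiple of `1 + ∫ f'²`. A wide tent placed far out
has little kinetic energy and sees only the tail of the potential, which gives the bound by the
upper limit. Scaling follows from dilation of test functions.

For existence, a minimizing sequence has a subsequence with weakly convergent derivatives and
pointwise convergent values. If the energy level lies below the lower limit of the potential,
escaping mass would be too expensive, and the limit is a normalized ground state. Absolute values of
ground states are ground states, and so are differences. By the Euler-Lagrange equation tested on
tents, a nonnegative ground state with an interior zero vanishes identically. Applied to the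
absolute value of a difference, this gives uniqueness.

If instead the level equals both the limit and an upper bound of the potential, the weak limit
satisfies the ground state inequality but its absolute value is concave, hence zero by
`IsGroundState.eq_zero_of_le`.

Both derivative formulas come from `hasGateauxDeriv_of_isMinimizingSeq`: near-minimizers of the
perturbed problem form a minimizing sequence for `U`, and the limits of `∫ W F²` along subsequences
determine the derivative once a linear upper bound is known. -/

/-! ### Primitives of square integrable functions -/

/-- `f` belongs to `H^1_0(ℝ⁺)` and is the primitive of its derivative `g`. -/
structure IsH1 (f g : ℝ → ℝ) : Prop where
  memLp : MemLp f 2 halfVolume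
  memLp_deriv : MemLp g 2 halfVolume
  eq_integral : ∀ x, 0 ≤ x → f x = ∫ t in (0 : ℝ)..x, g t

theorem intervalIntegrable_of_memLp {g : ℝ → ℝ} (hg : MemLp g 2 halfVolume) {a b : ℝ}
    (ha : 0 ≤ a) (hb : 0 ≤ b) : IntervalIntegrable g volume a b := by
  rw [intervalIntegrable_iff]
  have hs : uIoc a b ⊆ Ioi 0 := fun x hx => lt_of_le_of_lt (le_min ha hb) hx.1
  have h : MemLp g 2 (volume.restrict (uIoc a b)) :=
    hg.mono_measure (Measure.restrict_mono hs le_rfl)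
  have : IsFiniteMeasure (volume.restrict (uIoc a b)) := by
    rw [uIoc]; infer_instance
  exact h.integrable (by norm_num)

theorem ae_halfVolume_of_ae {p : ℝ → Prop} (h : ∀ x, 0 < x → p x) : ∀ᵐ x ∂halfVolume, p x := by
  rw [ae_restrict_iff' measurableSet_Ioi]
  exact Eventually.of_forall h

theorem integrable_mul_of_memLp {f g : ℝ → ℝ} (hf : MemLp f 2 halfVolume)
    (hg : MemLp g 2 halfVolume) : Integrable (fun x => f x * g x) halfVolume :=
  hf.integrable_mul hg

/-- The ε-δ condition involves only values in `[0, b]`, where `f` coincides with the indefinite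
integral; nothing is known about `f` on the negative axis. -/
theorem absolutelyContinuousOnInterval_of_primitive {f g : ℝ → ℝ} (hg : MemLp g 2 halfVolume)
    (hf : ∀ x, 0 ≤ x → f x = ∫ t in (0 : ℝ)..x, g t) {b : ℝ} (hb : 0 ≤ b) :
    AbsolutelyContinuousOnInterval f 0 b := by
  have h0 := (intervalIntegrable_of_memLp hg le_rfl
    hb).absolutelyContinuousOnInterval_intervalIntegral (c := 0) (by simp)
  rw [absolutelyContinuousOnInterval_iff] at h0 ⊢
  intro ε hε
  obtain ⟨δ, hδ, H⟩ := h0 ε hε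
  refine ⟨δ, hδ, fun E hE hlt => ?_⟩
  convert H E hE hlt using 1
  refine Finset.sum_congr rfl fun i hi => ?_
  have hm := hE.1 i hi
  rw [uIcc_of_le hb] at hm
  rw [hf _ hm.1.1, hf _ hm.2.1]

theorem continuousOn_of_primitive {f g : ℝ → ℝ} (hg : MemLp g 2 halfVolume)
    (hf : ∀ x, 0 ≤ x → f x = ∫ t in (0 : ℝ)..x, g t) : ContinuousOn f (Ici 0) := by
  intro x hx
  have hx : 0 ≤ x := hx
  have h1 := (absolutelyContinuousOnInterval_of_primitive hg hf (b := x + 1)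
    (by linarith)).continuousOn
  rw [uIcc_of_le (by linarith)] at h1
  refine (h1 x ⟨hx, by linarith⟩).mono_of_mem_nhdsWithin ?_
  exact mem_nhdsWithin.2 ⟨Iio (x + 1), isOpen_Iio, by simp, fun y hy => ⟨hy.2, le_of_lt hy.1⟩⟩

theorem ae_hasDerivAt_of_primitive {f g : ℝ → ℝ} (hg : MemLp g 2 halfVolume)
    (hf : ∀ x, 0 ≤ x → f x = ∫ t in (0 : ℝ)..x, g t) : ∀ᵐ x ∂halfVolume, HasDerivAt f (g x) x := by
  have key : ∀ n : ℕ, ∀ᵐ x, x ∈ Ioo (0 : ℝ) n → HasDerivAt f (g x) x := by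
    intro n
    have hn : (0 : ℝ) ≤ n := Nat.cast_nonneg n
    filter_upwards [(intervalIntegrable_of_memLp hg le_rfl hn).ae_hasDerivAt_integral]
      with x hx hxn
    have := hx (by rw [uIcc_of_le hn]; exact Ioo_subset_Icc_self hxn) 0 (by simp)
    refine this.congr_of_eventuallyEq ?_
    filter_upwards [Ioi_mem_nhds hxn.1] with y hy
    exact hf y (le_of_lt hy)
  rw [ae_restrict_iff' measurableSet_Ioi]
  filter_upwards [ae_all_iff.2 key] with x hx hx0
  obtain ⟨n, hn⟩ := exists_nat_gt x
  exact hx n ⟨hx0, hn⟩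

namespace IsH1

variable {f g f₁ g₁ f₂ g₂ : ℝ → ℝ}

theorem sub_eq (h : IsH1 f g) {a b : ℝ} (ha : 0 ≤ a) (hb : 0 ≤ b) :
    f b - f a = ∫ t in a..b, g t := by
  rw [h.eq_integral a ha, h.eq_integral b hb]
  exact intervalIntegral.integral_interval_sub_left
    (intervalIntegrable_of_memLp h.memLp_deriv le_rfl hb)
    (intervalIntegrable_of_memLp h.memLp_deriv le_rfl ha)

theorem map_zero (h : IsH1 f g) : f 0 = 0 := by
  simpa using h.eq_integral 0 le_rfl

theorem integrable_sq (h : IsH1 f g) : Integrable (fun x => f x ^ 2) halfVolume :=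
  h.memLp.integrable_sq

theorem integrable_deriv_sq (h : IsH1 f g) : Integrable (fun x => g x ^ 2) halfVolume :=
  h.memLp_deriv.integrable_sq

theorem add (h₁ : IsH1 f₁ g₁) (h₂ : IsH1 f₂ g₂) :
    IsH1 (fun x => f₁ x + f₂ x) (fun x => g₁ x + g₂ x) where
  memLp := h₁.memLp.add h₂.memLp
  memLp_deriv := h₁.memLp_deriv.add h₂.memLp_deriv
  eq_integral x hx := by
    rw [h₁.eq_integral x hx, h₂.eq_integral x hx]
    exact (intervalIntegral.integral_add
      (intervalIntegrable_of_memLp h₁.memLp_deriv le_rfl hx)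
      (intervalIntegrable_of_memLp h₂.memLp_deriv le_rfl hx)).symm

theorem const_mul (h : IsH1 f g) (c : ℝ) : IsH1 (fun x => c * f x) (fun x => c * g x) where
  memLp := h.memLp.const_mul c
  memLp_deriv := h.memLp_deriv.const_mul c
  eq_integral x hx := by
    rw [h.eq_integral x hx, intervalIntegral.integral_const_mul]

theorem absolutelyContinuousOnInterval (h : IsH1 f g) {b : ℝ} (hb : 0 ≤ b) :
    AbsolutelyContinuousOnInterval f 0 b :=
  absolutelyContinuousOnInterval_of_primitive h.memLp_deriv h.eq_integral hb

theorem continuousOn (h : IsH1 f g) : ContinuousOn f (Ici 0) :=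
  continuousOn_of_primitive h.memLp_deriv h.eq_integral

theorem ae_hasDerivAt (h : IsH1 f g) : ∀ᵐ x ∂halfVolume, HasDerivAt f (g x) x :=
  ae_hasDerivAt_of_primitive h.memLp_deriv h.eq_integral

/-- The absolute value of a function in `H^1_0(ℝ⁺)`. -/
theorem abs (h : IsH1 f g) : ∃ g' : ℝ → ℝ, IsH1 (fun x => |f x|) g' ∧
    ∀ᵐ x ∂halfVolume, |g' x| ≤ |g x| := by
  have hac : ∀ b : ℝ, 0 ≤ b → AbsolutelyContinuousOnInterval (fun x => |f x|) 0 b := by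
    intro b hb
    have h0 := h.absolutelyContinuousOnInterval hb
    rw [absolutelyContinuousOnInterval_iff] at h0 ⊢
    intro ε hε
    obtain ⟨δ, hδ, H⟩ := h0 ε hε
    refine ⟨δ, hδ, fun E hE hlt => lt_of_le_of_lt ?_ (H E hE hlt)⟩
    exact Finset.sum_le_sum fun i _ => abs_abs_sub_abs_le _ _
  have hle : ∀ᵐ x ∂halfVolume, |deriv (fun x => |f x|) x| ≤ |g x| := by
    filter_upwards [h.ae_hasDerivAt] with x hx
    by_cases hd : DifferentiableAt ℝ (fun x => |f x|) x
    -- Difference quotients of `|f|` are dominated by those of `f` in absolute value, and this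
    -- passes to the limit.
    · have t1 := (hasDerivAt_iff_tendsto_slope.1 hd.hasDerivAt).abs
      have t2 := (hasDerivAt_iff_tendsto_slope.1 hx).abs
      refine le_of_tendsto_of_tendsto' t1 t2 fun y => ?_
      simp only [slope, vsub_eq_sub, smul_eq_mul, abs_mul]
      exact mul_le_mul_of_nonneg_left (abs_abs_sub_abs_le _ _) (abs_nonneg _)
    · rw [deriv_zero_of_not_differentiableAt hd, abs_zero]
      exact abs_nonneg _
  refine ⟨deriv (fun x => |f x|), ⟨?_, ?_, ?_⟩, hle⟩
  · exact h.memLp.norm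
  · exact h.memLp_deriv.mono (measurable_deriv _).aestronglyMeasurable hle
  · intro x hx
    rw [(hac x hx).integral_deriv_eq_sub]
    simp [h.map_zero]

end IsH1

/-! ### Pointwise bounds by the `H¹` norm -/

/-- Cauchy-Schwarz inequality on an interval. -/
theorem sq_integral_le {g : ℝ → ℝ} (hg : MemLp g 2 halfVolume) {a b : ℝ}
    (ha : 0 ≤ a) (hab : a ≤ b) :
    (∫ t in a..b, g t) ^ 2 ≤ (b - a) * ∫ t in Ioc a b, g t ^ 2 := by
  rcases hab.eq_or_lt with rfl | hlt
  · simp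
  have hs : Ioc a b ⊆ Ioi 0 := fun x hx => lt_of_le_of_lt ha hx.1
  have h : MemLp g 2 (volume.restrict (Ioc a b)) :=
    hg.mono_measure (Measure.restrict_mono hs le_rfl)
  have i1 : Integrable g (volume.restrict (Ioc a b)) := h.integrable (by norm_num)
  have i2 := h.integrable_sq
  rw [intervalIntegral.integral_of_le hab]
  set I := ∫ t in Ioc a b, g t
  -- `m` is the mean of `g`; the inequality says that the variance is nonnegative.
  set m := I / (b - a)
  have e : ∫ t in Ioc a b, (g t - m) ^ 2
      = (∫ t in Ioc a b, g t ^ 2) - 2 * m * I + m ^ 2 * (b - a) := by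
    have : ∀ t, (g t - m) ^ 2 = g t ^ 2 - 2 * m * g t + m ^ 2 := fun t => by ring
    simp_rw [this]
    have i3 : Integrable (fun t => 2 * m * g t) (volume.restrict (Ioc a b)) := i1.const_mul _
    have i4 : Integrable (fun t => g t ^ 2 - 2 * m * g t) (volume.restrict (Ioc a b)) := i2.sub i3
    rw [integral_add i4 (integrable_const _), integral_sub i2 i3, integral_const_mul]
    simp [hab, mul_comm]
    exact Or.inl rfl
  have hp : 0 ≤ ∫ t in Ioc a b, (g t - m) ^ 2 := integral_nonneg fun t => sq_nonneg _
  have hb : 0 < b - a := sub_pos.2 hlt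
  have hm : m * (b - a) = I := div_mul_cancel₀ _ hb.ne'
  rw [e] at hp
  have := mul_nonneg hb.le hp
  nlinarith

/-- Local bound for functions in `H^1`. -/
theorem IsH1.sq_le_local {f g : ℝ → ℝ} (h : IsH1 f g) {a x : ℝ} (ha : 0 ≤ a)
    (hx : x ∈ Icc a (a + 1)) :
    f x ^ 2 ≤ 2 * ((∫ t in Ioc a (a + 1), f t ^ 2) + ∫ t in Ioc a (a + 1), g t ^ 2) := by
  set G := ∫ t in Ioc a (a + 1), g t ^ 2 with hG
  have hs : Ioc a (a + 1) ⊆ Ioi 0 := fun x hx => lt_of_le_of_lt ha hx.1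
  have hgi : IntegrableOn (fun t => g t ^ 2) (Ioc a (a + 1)) :=
    h.integrable_deriv_sq.mono_measure (Measure.restrict_mono hs le_rfl)
  have hfi : IntegrableOn (fun t => f t ^ 2) (Ioc a (a + 1)) :=
    h.integrable_sq.mono_measure (Measure.restrict_mono hs le_rfl)
  have main : ∀ u v, a ≤ u → u ≤ v → v ≤ a + 1 → (f v - f u) ^ 2 ≤ G := by
    intro u v hu huv hv
    rw [h.sub_eq (ha.trans hu) (ha.trans (hu.trans huv))]
    refine (sq_integral_le h.memLp_deriv (ha.trans hu) huv).trans ?_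
    have h1 : ∫ t in Ioc u v, g t ^ 2 ≤ G :=
      setIntegral_mono_set hgi (Eventually.of_forall fun t => sq_nonneg _)
        (Ioc_subset_Ioc hu hv).eventuallyLE
    have h2 : 0 ≤ ∫ t in Ioc u v, g t ^ 2 := integral_nonneg fun t => sq_nonneg _
    nlinarith
  have hb : ∀ y ∈ Ioc a (a + 1), f x ^ 2 ≤ 2 * f y ^ 2 + 2 * G := by
    intro y hy
    have h1 : (f x - f y) ^ 2 ≤ G := by
      rcases le_total x y with hxy | hxy
      · have := main x y hx.1 hxy hy.2
        nlinarith
      · exact main y x hy.1.le hxy hx.2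
    -- The square in the hint equals `2 f(y)² + 2 (f(x) - f(y))² - f(x)²`.
    nlinarith [sq_nonneg (f x - 2 * f y)]
  have i1 : IntegrableOn (fun t => 2 * f t ^ 2) (Ioc a (a + 1)) := hfi.const_mul 2
  have i2 : IntegrableOn (fun _ : ℝ => 2 * G) (Ioc a (a + 1)) := integrable_const _
  have i3 : IntegrableOn (fun t => 2 * f t ^ 2 + 2 * G) (Ioc a (a + 1)) := i1.add i2
  have hi := setIntegral_mono_on (μ := volume) (s := Ioc a (a + 1)) (f := fun _ => f x ^ 2)
    (g := fun y => 2 * f y ^ 2 + 2 * G) (integrable_const _) i3 measurableSet_Ioc hb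
  rw [integral_add i1 i2, integral_const_mul] at hi
  simp at hi
  linarith

theorem IsH1.sq_le {f g : ℝ → ℝ} (h : IsH1 f g) {x : ℝ} (hx : 0 ≤ x) :
    f x ^ 2 ≤ 2 * ((∫ t in Ioi 0, f t ^ 2) + ∫ t in Ioi 0, g t ^ 2) := by
  have hs : Ioc x (x + 1) ⊆ Ioi 0 := fun y hy => lt_of_le_of_lt hx hy.1
  have h0 := h.sq_le_local hx (x := x) (by simp)
  have h1 : ∫ t in Ioc x (x + 1), f t ^ 2 ≤ ∫ t in Ioi 0, f t ^ 2 :=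
    setIntegral_mono_set h.integrable_sq (Eventually.of_forall fun t => sq_nonneg _)
      hs.eventuallyLE
  have h2 : ∫ t in Ioc x (x + 1), g t ^ 2 ≤ ∫ t in Ioi 0, g t ^ 2 :=
    setIntegral_mono_set h.integrable_deriv_sq (Eventually.of_forall fun t => sq_nonneg _)
      hs.eventuallyLE
  linarith

/-! ### Weak derivatives and primitives -/

/-- Integration by parts against a test function. -/
theorem isWeakDeriv_of_primitive {f g : ℝ → ℝ} (hg : MemLp g 2 halfVolume)
    (hf : ∀ x, 0 ≤ x → f x = ∫ t in (0 : ℝ)..x, g t) : IsWeakDeriv f g := by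
  intro φ hφ hc hs
  obtain ⟨b, hb⟩ := hc.isCompact.bddAbove
  set B := max b 0
  have hB : 0 ≤ B := le_max_right _ _
  have hz : ∀ x, B < x → φ x = 0 := fun x hx => image_eq_zero_of_notMem_tsupport fun hm =>
    absurd (hb hm) (not_le.2 (lt_of_le_of_lt (le_max_left _ _) hx))
  have hz' : ∀ x, B < x → deriv φ x = 0 := fun x hx =>
    image_eq_zero_of_notMem_tsupport fun hm =>
      absurd (hb (tsupport_deriv_subset hm)) (not_le.2 (lt_of_le_of_lt (le_max_left _ _) hx))
  have h0 : φ 0 = 0 := image_eq_zero_of_notMem_tsupport fun hm =>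
    lt_irrefl (0 : ℝ) (hs hm)
  -- `B` may belong to the support, so the value there is obtained as a limit from the right.
  have hφB : φ B = 0 := by
    have : Tendsto φ (𝓝[>] B) (𝓝 (φ B)) := (hφ.continuous.tendsto B).mono_left nhdsWithin_le_nhds
    refine tendsto_nhds_unique this (tendsto_const_nhds.congr' ?_)
    filter_upwards [self_mem_nhdsWithin] with x hx using (hz x hx).symm
  have hred : ∀ u : ℝ → ℝ, (∀ x, B < x → u x = 0) →
      ∫ x in Ioi 0, u x = ∫ x in (0 : ℝ)..B, u x := by
    intro u hu
    rw [intervalIntegral.integral_of_le hB]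
    refine (setIntegral_eq_of_subset_of_forall_sdiff_eq_zero measurableSet_Ioi
      Ioc_subset_Ioi_self fun x hx => hu x ?_)
    by_contra hn
    exact hx.2 ⟨hx.1, not_lt.1 hn⟩
  rw [hred _ fun x hx => by rw [hz' x hx, mul_zero], hred _ fun x hx => by rw [hz x hx, mul_zero]]
  have hacφ : AbsolutelyContinuousOnInterval φ 0 B :=
    (hφ.of_le (by simp)).contDiffOn.absolutelyContinuousOnInterval
  rw [(absolutelyContinuousOnInterval_of_primitive hg hf hB).integral_mul_deriv_eq_deriv_mul hacφ,
    h0, hφB]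
  simp only [mul_zero, sub_zero, zero_sub, neg_inj]
  refine intervalIntegral.integral_congr_ae ?_
  have := ae_hasDerivAt_of_primitive hg hf
  rw [ae_restrict_iff' measurableSet_Ioi] at this
  filter_upwards [this] with x hx hx'
  rw [uIoc_of_le hB] at hx'
  rw [(hx hx'.1).deriv]

theorem IsH1.isWeakDeriv {f g : ℝ → ℝ} (h : IsH1 f g) : IsWeakDeriv f g :=
  isWeakDeriv_of_primitive h.memLp_deriv h.eq_integral

theorem IsH1.memH10 {f g : ℝ → ℝ} (h : IsH1 f g) : MemH10 f where
  continuousOn := h.continuousOn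
  map_zero := h.map_zero
  memLp := h.memLp
  exists_weakDeriv := ⟨g, h.memLp_deriv, h.isWeakDeriv⟩

theorem IsH1.weakDeriv_ae_eq {f g : ℝ → ℝ} (h : IsH1 f g) : weakDeriv f =ᵐ[halfVolume] g :=
  HalfLine.weakDeriv_ae_eq h.memLp_deriv h.isWeakDeriv

/-- Mollified values of a continuous function converge to its values. -/
theorem tendsto_integral_smoothTransition {D : ℝ → ℝ} (hD : ContinuousOn D (Ici 0)) {a : ℝ}
    (ha : 0 < a) :
    Tendsto (fun n : ℕ => ∫ x in Ioi 0,
      D x * deriv (fun y => Real.smoothTransition ((n + 1 : ℝ) * (y - a))) x) atTop (𝓝 (D a)) := by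
  have hdiff : ∀ n : ℕ, ContDiff ℝ ∞ fun y => Real.smoothTransition ((n + 1 : ℝ) * (y - a)) :=
    fun n => Real.smoothTransition.contDiff.comp (by fun_prop)
  rw [Metric.tendsto_atTop]
  intro ε hε
  obtain ⟨δ, hδ, H⟩ := Metric.continuousWithinAt_iff.1 (hD a ha.le) (ε / 2) (by positivity)
  obtain ⟨N, hN⟩ := exists_nat_one_div_lt hδ
  refine ⟨N, fun n hn => ?_⟩
  -- `η` climbs from 0 to 1 on `[a, c]`, so its derivative is an approximate identity concentrating
  -- at `a` from the right.
  set η : ℝ → ℝ := fun y => Real.smoothTransition ((n + 1 : ℝ) * (y - a)) with hη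
  have hn1 : (0 : ℝ) < n + 1 := by positivity
  set c : ℝ := a + 1 / (n + 1) with hcdef
  have hac : a ≤ c := by simp only [hcdef]; linarith [one_div_pos.2 hn1]
  have hcδ : c - a < δ := by
    refine lt_of_le_of_lt ?_ hN
    simp only [hcdef, add_sub_cancel_left]
    exact one_div_le_one_div_of_le (by positivity) (by exact_mod_cast Nat.succ_le_succ hn)
  have hmono : Monotone η := fun x y hxy => Real.smoothTransition.monotone (by gcongr)
  have hnn : ∀ x, 0 ≤ deriv η x := fun x => hmono.deriv_nonneg
  have hcont : Continuous (deriv η) := (hdiff n).continuous_deriv (by simp)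
  have hzl : ∀ x, x < a → deriv η x = 0 := by
    intro x hx
    have : η =ᶠ[𝓝 x] fun _ => 0 := by
      filter_upwards [Iio_mem_nhds hx] with y hy
      exact Real.smoothTransition.zero_of_nonpos
        (mul_nonpos_of_nonneg_of_nonpos hn1.le (by linarith [show y < a from hy]))
    rw [this.deriv_eq, deriv_const]
  have hzr : ∀ x, c < x → deriv η x = 0 := by
    intro x hx
    have : η =ᶠ[𝓝 x] fun _ => 1 := by
      filter_upwards [Ioi_mem_nhds hx] with y hy
      refine Real.smoothTransition.one_of_one_le ?_
      have hy : a + 1 / (n + 1) < y := hy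
      have : 1 / ((n : ℝ) + 1) < y - a := by linarith
      rw [div_lt_iff₀ hn1] at this
      linarith
    rw [this.deriv_eq, deriv_const]
  have hIcc : ∫ x in Ioi 0, D x * deriv η x = ∫ x in a..c, D x * deriv η x := by
    rw [intervalIntegral.integral_of_le hac, ← integral_Icc_eq_integral_Ioc]
    refine setIntegral_eq_of_subset_of_forall_sdiff_eq_zero measurableSet_Ioi
      (fun x hx => lt_of_lt_of_le ha hx.1) fun x hx => ?_
    by_cases h1 : x < a
    · rw [hzl x h1, mul_zero]
    · rw [hzr x (not_le.1 fun h2 => hx.2 ⟨not_lt.1 h1, h2⟩), mul_zero]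
  have hone : ∫ x in a..c, deriv η x = 1 := by
    rw [intervalIntegral.integral_deriv_eq_sub
      (fun x _ => ((hdiff n).differentiable (by simp)).differentiableAt)
      (hcont.intervalIntegrable _ _)]
    have e1 : (n + 1 : ℝ) * (c - a) = 1 := by simp only [hcdef]; field_simp; ring
    simp only [e1]
    simp
  have hDi : IntervalIntegrable (fun x => D x * deriv η x) volume a c := by
    refine ContinuousOn.intervalIntegrable ?_
    rw [uIcc_of_le hac]
    exact (hD.mono fun x hx => ha.le.trans hx.1).mul hcont.continuousOn
  have hsub : (∫ x in a..c, D x * deriv η x) - D a = ∫ x in a..c, (D x - D a) * deriv η x := by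
    simp_rw [sub_mul]
    rw [intervalIntegral.integral_sub hDi ((hcont.intervalIntegrable _ _).const_mul _),
      intervalIntegral.integral_const_mul, hone, mul_one]
  rw [Real.dist_eq, hIcc, hsub]
  have hle : ‖∫ x in a..c, (D x - D a) * deriv η x‖ ≤ ∫ x in a..c, ε / 2 * deriv η x := by
    refine intervalIntegral.norm_integral_le_of_norm_le hac
      (Eventually.of_forall fun x hx => ?_) ((hcont.intervalIntegrable _ _).const_mul _)
    rw [norm_mul, Real.norm_of_nonneg (hnn x)]
    refine mul_le_mul_of_nonneg_right ?_ (hnn x)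
    have := H (x := x) (ha.le.trans hx.1.le) (by
      rw [Real.dist_eq, abs_of_nonneg (by linarith [hx.1])]; linarith [hx.2])
    exact this.le
  rw [intervalIntegral.integral_const_mul, hone, Real.norm_eq_abs] at hle
  linarith

/-- A continuous function with zero weak derivative is constant. -/
theorem eq_of_isWeakDeriv_zero {D : ℝ → ℝ} (hD : ContinuousOn D (Ici 0))
    (h : IsWeakDeriv D 0) {a b : ℝ} (ha : 0 < a) (hb : 0 < b) : D a = D b := by
  wlog hab : a ≤ b generalizing a b
  · exact (this hb ha (le_of_not_ge hab)).symm
  have hdiff : ∀ (n : ℕ) (c : ℝ),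
      ContDiff ℝ ∞ fun y => Real.smoothTransition ((n + 1 : ℝ) * (y - c)) :=
    fun n c => Real.smoothTransition.contDiff.comp (by fun_prop)
  have hzl : ∀ (n : ℕ) (c x : ℝ), x ≤ c → Real.smoothTransition ((n + 1 : ℝ) * (x - c)) = 0 :=
    fun n c x hx => Real.smoothTransition.zero_of_nonpos
      (mul_nonpos_of_nonneg_of_nonpos (by positivity) (by linarith))
  have hzr : ∀ (n : ℕ) (c x : ℝ), c + 1 ≤ x → Real.smoothTransition ((n + 1 : ℝ) * (x - c)) = 1 :=
    fun n c x hx => Real.smoothTransition.one_of_one_le (by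
      have : (0 : ℝ) ≤ n := Nat.cast_nonneg n
      nlinarith)
  refine tendsto_nhds_unique (tendsto_integral_smoothTransition hD ha)
    ((tendsto_integral_smoothTransition hD hb).congr fun n => ?_)
  set ηa : ℝ → ℝ := fun y => Real.smoothTransition ((n + 1 : ℝ) * (y - a))
  set ηb : ℝ → ℝ := fun y => Real.smoothTransition ((n + 1 : ℝ) * (y - b))
  -- The difference of two smooth steps is an admissible test function, and testing `D` against its
  -- derivative compares the mollified values at `a` and `b`.
  have hsupp : Function.support (fun y => ηa y - ηb y) ⊆ Icc a (b + 1) := by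
    intro x hx
    by_contra hn
    refine hx ?_
    simp only [ηa, ηb]
    by_cases h1 : x < a
    · rw [hzl n a x h1.le, hzl n b x (by linarith), sub_self]
    · have : b + 1 < x := not_le.1 fun h2 => hn ⟨not_lt.1 h1, h2⟩
      rw [hzr n a x (by linarith), hzr n b x this.le, sub_self]
  have hts : tsupport (fun y => ηa y - ηb y) ⊆ Icc a (b + 1) :=
    closure_minimal hsupp isClosed_Icc
  have key := h (fun y => ηa y - ηb y) ((hdiff n a).sub (hdiff n b))
    (HasCompactSupport.of_support_subset_isCompact isCompact_Icc hsupp)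
    (hts.trans fun x hx => lt_of_lt_of_le ha hx.1)
  have hd : deriv (fun y => ηa y - ηb y) = fun x => deriv ηa x - deriv ηb x := by
    funext x
    exact deriv_fun_sub ((hdiff n a).differentiable (by simp)).differentiableAt
      ((hdiff n b).differentiable (by simp)).differentiableAt
  have hint : ∀ c, 0 < c → Integrable (fun x => D x *
      deriv (fun y => Real.smoothTransition ((n + 1 : ℝ) * (y - c))) x) halfVolume := by
    intro c hc
    set η : ℝ → ℝ := fun y => Real.smoothTransition ((n + 1 : ℝ) * (y - c))
    have hcont : Continuous (deriv η) := (hdiff n c).continuous_deriv (by simp)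
    have hI : IntegrableOn (fun x => D x * deriv η x) (Icc 0 (c + 1)) :=
      ((hD.mono fun x hx => hx.1).mul hcont.continuousOn).integrableOn_compact isCompact_Icc
    have : IntegrableOn (fun x => D x * deriv η x) (Ioi 0) := by
      refine (hI.of_forall_sdiff_eq_zero measurableSet_Ioi fun x hx => ?_)
      have hx1 : c + 1 < x := not_le.1 fun h2 => hx.2 ⟨le_of_lt hx.1, h2⟩
      have : η =ᶠ[𝓝 x] fun _ => 1 := by
        filter_upwards [Ioi_mem_nhds hx1] with y hy
        exact hzr n c y (le_of_lt hy)
      rw [this.deriv_eq, deriv_const, mul_zero]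
    exact this
  rw [hd] at key
  simp_rw [mul_sub] at key
  rw [integral_sub (hint a ha) (hint b hb)] at key
  simp at key
  linarith

/-- Functions in `H^1_0(ℝ⁺)` are primitives of their weak derivatives. -/
theorem MemH10.isH1 {f : ℝ → ℝ} (h : MemH10 f) : IsH1 f (weakDeriv f) := by
  obtain ⟨g, hg, hw⟩ := h.exists_weakDeriv
  have hae := HalfLine.weakDeriv_ae_eq hg hw
  have hg' : MemLp (weakDeriv f) 2 halfVolume := (memLp_congr_ae hae).2 hg
  refine ⟨h.memLp, hg', ?_⟩
  -- `f - F` has zero weak derivative, hence is constant on the open half-line; continuity at 0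
  -- identifies the constant as 0.
  set F : ℝ → ℝ := fun x => ∫ t in (0 : ℝ)..x, weakDeriv f t
  have hF : ∀ x, 0 ≤ x → F x = ∫ t in (0 : ℝ)..x, weakDeriv f t := fun x _ => rfl
  have hFc := continuousOn_of_primitive hg' hF
  have hint : ∀ u : ℝ → ℝ, ContinuousOn u (Ici 0) → ∀ φ : ℝ → ℝ, ContDiff ℝ ∞ φ →
      HasCompactSupport φ → Integrable (fun x => u x * deriv φ x) halfVolume := by
    intro u hu φ hφ hc
    obtain ⟨b, hb⟩ := hc.isCompact.bddAbove
    have hI : IntegrableOn (fun x => u x * deriv φ x) (Icc 0 b) :=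
      ((hu.mono fun x hx => hx.1).mul
        (hφ.continuous_deriv (by simp)).continuousOn).integrableOn_compact isCompact_Icc
    refine hI.of_forall_sdiff_eq_zero measurableSet_Ioi fun x hx => ?_
    rw [image_eq_zero_of_notMem_tsupport (f := deriv φ) fun hm =>
      hx.2 ⟨le_of_lt hx.1, hb (tsupport_deriv_subset hm)⟩, mul_zero]
  have hD : IsWeakDeriv (fun x => f x - F x) 0 := by
    intro φ hφ hc hs
    simp_rw [sub_mul]
    rw [integral_sub (hint f h.continuousOn φ hφ hc) (hint F hFc φ hφ hc), hw φ hφ hc hs,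
      isWeakDeriv_of_primitive hg' hF φ hφ hc hs]
    have : ∫ x in Ioi 0, weakDeriv f x * φ x = ∫ x in Ioi 0, g x * φ x :=
      integral_congr_ae (by filter_upwards [hae] with x hx; rw [hx])
    rw [this]
    simp
  have hDc := h.continuousOn.sub hFc
  have hconst : ∀ x, 0 < x → f x - F x = 0 := by
    intro x hx
    have h0 : Tendsto (fun y => f y - F y) (𝓝[>] 0) (𝓝 (f 0 - F 0)) :=
      (hDc 0 self_mem_Ici).mono_left (nhdsWithin_mono _ Ioi_subset_Ici_self)
    have h1 : f 0 - F 0 = 0 := by simp [h.map_zero, F]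
    rw [h1] at h0
    refine tendsto_nhds_unique (tendsto_const_nhds.congr' ?_) h0
    filter_upwards [self_mem_nhdsWithin] with y hy
    exact eq_of_isWeakDeriv_zero hDc hD hx hy
  intro x hx
  rcases hx.eq_or_lt with rfl | hx
  · simp [h.map_zero]
  · exact sub_eq_zero.1 (hconst x hx)

/-! ### Admissible potentials and real-valued energies -/

/-- Locally integrable potentials that are bounded below. -/
structure IsAdmissible (U : ℝ → ℝ) : Prop where
  locallyIntegrableOn : LocallyIntegrableOn U (Ioi 0)
  bddBelow : ∃ C : ℝ, ∀ᵐ ξ ∂halfVolume, -C ≤ U ξ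

theorem IsPotential.isAdmissible {U : ℝ → ℝ} (hU : IsPotential U) : IsAdmissible U :=
  ⟨hU.locallyIntegrableOn, 0, by simpa using hU.nonneg⟩

theorem IsAdmissible.aestronglyMeasurable {U : ℝ → ℝ} (hU : IsAdmissible U) :
    AEStronglyMeasurable U halfVolume :=
  hU.locallyIntegrableOn.aestronglyMeasurable

/-- The perturbed potentials in the Gâteaux derivative may be negative, which is why the theory is
set up for potentials bounded below. -/
theorem IsAdmissible.add_mul {U W : ℝ → ℝ} (hU : IsAdmissible U) (hW : IsBoundedCompact W)
    (t : ℝ) : IsAdmissible fun ξ => U ξ + t * W ξ := by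
  obtain ⟨C, hC⟩ := hW.bounded
  refine ⟨?_, ?_⟩
  · have hWl : LocallyIntegrableOn W (Ioi 0) := by
      have hmem : MemLp W ∞ halfVolume :=
        memLp_top_of_bound hW.aestronglyMeasurable C (by simpa using hC)
      exact locallyIntegrableOn_of_locallyIntegrable_restrict (hmem.locallyIntegrable le_top)
    exact hU.locallyIntegrableOn.add (hWl.smul t)
  · obtain ⟨D, hD⟩ := hU.bddBelow
    refine ⟨D + |t| * C, ?_⟩
    filter_upwards [hC, hD] with x hx hx'
    have h1 : |t * W x| ≤ |t| * C := by
      rw [abs_mul]; exact mul_le_mul_of_nonneg_left hx (abs_nonneg t)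
    linarith [neg_abs_le (t * W x)]

theorem energy_eq {U f g : ℝ → ℝ} (h : IsH1 f g)
    (hi : Integrable (fun x => U x * f x ^ 2) halfVolume) :
    energy U f = (((∫ x in Ioi 0, g x ^ 2) + ∫ x in Ioi 0, U x * f x ^ 2 : ℝ) : EReal) := by
  have hA : ∫⁻ ξ in Ioi 0, ENNReal.ofReal (weakDeriv f ξ ^ 2)
      = ENNReal.ofReal (∫ x in Ioi 0, g x ^ 2) := by
    rw [ofReal_integral_eq_lintegral_ofReal h.integrable_deriv_sq
      (Eventually.of_forall fun x => sq_nonneg _)]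
    exact lintegral_congr_ae (by filter_upwards [h.weakDeriv_ae_eq] with x hx; rw [hx])
  have hP := hi.lintegral_lt_top
  have hN := hi.neg.lintegral_lt_top
  simp only [Pi.neg_apply] at hN
  rw [energy, hA, integral_eq_lintegral_pos_part_sub_lintegral_neg_part hi]
  lift ∫⁻ ξ in Ioi 0, ENNReal.ofReal (U ξ * f ξ ^ 2) to NNReal using hP.ne with p
  lift ∫⁻ ξ in Ioi 0, ENNReal.ofReal (-(U ξ * f ξ ^ 2)) to NNReal using hN.ne with n
  have ha : 0 ≤ ∫ x in Ioi 0, g x ^ 2 := integral_nonneg fun x => sq_nonneg _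
  simp only [EReal.coe_ennreal_add, EReal.coe_ennreal_ofReal, max_eq_left ha,
    ENNReal.coe_toReal, EReal.coe_add, EReal.coe_sub, EReal.coe_nnreal_eq_coe_real]
  norm_cast
  ring

/-- The negative part of `U f²` is dominated by a multiple of `f²`, so integrability can fail only
through an infinite positive part. -/
theorem energy_eq_top {U f g : ℝ → ℝ} (hU : IsAdmissible U) (h : IsH1 f g)
    (hi : ¬ Integrable (fun x => U x * f x ^ 2) halfVolume) : energy U f = ⊤ := by
  obtain ⟨C, hC⟩ := hU.bddBelow
  have hm : AEStronglyMeasurable (fun x => U x * f x ^ 2) halfVolume :=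
    hU.aestronglyMeasurable.mul h.integrable_sq.aestronglyMeasurable
  have hN : ∫⁻ ξ in Ioi 0, ENNReal.ofReal (-(U ξ * f ξ ^ 2)) ≠ ⊤ := by
    refine ((lintegral_mono_ae ?_).trans_lt (h.integrable_sq.const_mul C).lintegral_lt_top).ne
    filter_upwards [hC] with x hx
    exact ENNReal.ofReal_le_ofReal (by nlinarith [sq_nonneg (f x)])
  have hP : ∫⁻ ξ in Ioi 0, ENNReal.ofReal (U ξ * f ξ ^ 2) = ⊤ := by
    by_contra hP
    refine hi ⟨hm, ?_⟩
    rw [hasFiniteIntegral_iff_norm]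
    have : ∀ x, ENNReal.ofReal ‖U x * f x ^ 2‖
        ≤ ENNReal.ofReal (U x * f x ^ 2) + ENNReal.ofReal (-(U x * f x ^ 2)) := by
      intro x
      rcases le_total 0 (U x * f x ^ 2) with h0 | h0
      · rw [Real.norm_of_nonneg h0]; exact le_self_add
      · rw [Real.norm_of_nonpos h0]; exact le_add_self
    refine (lintegral_mono this).trans_lt ?_
    rw [lintegral_add_left' hm.aemeasurable.ennreal_ofReal]
    exact ENNReal.add_lt_top.2 ⟨lt_top_iff_ne_top.2 hP, lt_top_iff_ne_top.2 hN⟩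
  rw [energy, hP]
  lift ∫⁻ ξ in Ioi 0, ENNReal.ofReal (-(U ξ * f ξ ^ 2)) to NNReal using hN with n
  rw [add_top, EReal.coe_ennreal_top, EReal.coe_nnreal_eq_coe_real]
  exact EReal.top_sub_coe _

/-! ### Tent functions -/

/-- The piecewise linear function with value `1` at `p` that vanishes outside `[a, b]`. -/
def tent (a p b x : ℝ) : ℝ := max 0 (min ((x - a) / (p - a)) ((b - x) / (b - p)))

/-- The derivative of `tent a p b`. -/
def tentDeriv (a p b x : ℝ) : ℝ :=
  (Ioc a p).indicator (fun _ => (p - a)⁻¹) x - (Ioc p b).indicator (fun _ => (b - p)⁻¹) x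

section Tent

variable {a p b : ℝ}

theorem tent_nonneg (a p b x : ℝ) : 0 ≤ tent a p b x := le_max_left _ _

theorem tent_le_one (hap : a < p) (hpb : p < b) (x : ℝ) : tent a p b x ≤ 1 := by
  refine max_le zero_le_one ?_
  rcases le_total x p with h | h
  · exact (min_le_left _ _).trans (by rw [div_le_one (by linarith)]; linarith)
  · exact (min_le_right _ _).trans (by rw [div_le_one (by linarith)]; linarith)

theorem continuous_tent (a p b : ℝ) : Continuous (tent a p b) := by
  unfold tent
  fun_prop

theorem tent_eq_zero (hap : a < p) (hpb : p < b) {x : ℝ} (hx : x ∉ Icc a b) :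
    tent a p b x = 0 := by
  refine max_eq_left ?_
  by_cases h : x < a
  · exact (min_le_left _ _).trans (div_nonpos_of_nonpos_of_nonneg (by linarith) (by linarith))
  · have : b < x := not_le.1 fun h2 => hx ⟨not_lt.1 h, h2⟩
    exact (min_le_right _ _).trans (div_nonpos_of_nonpos_of_nonneg (by linarith) (by linarith))

theorem integral_indicator_Ioc {a b x : ℝ} (c : ℝ) (ha : 0 ≤ a) (hx : 0 ≤ x) :
    ∫ t in (0 : ℝ)..x, (Ioc a b).indicator (fun _ => c) t = max (min x b - a) 0 * c := by
  rw [intervalIntegral.integral_of_le hx, setIntegral_indicator measurableSet_Ioc,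
    Ioc_inter_Ioc, setIntegral_const, max_eq_right ha, Measure.real, Real.volume_Ioc,
    ENNReal.toReal_ofReal', smul_eq_mul]

theorem memLp_indicator_Ioc (a b c : ℝ) :
    MemLp ((Ioc a b).indicator fun _ => c) 2 halfVolume := by
  refine memLp_indicator_const 2 measurableSet_Ioc c (Or.inr ?_)
  refine ((Measure.restrict_apply_le _ _).trans_lt ?_).ne
  simp

theorem isH1_tent (ha : 0 ≤ a) (hap : a < p) (hpb : p < b) :
    IsH1 (tent a p b) (tentDeriv a p b) where
  memLp := by
    have : tent a p b = (Icc a b).indicator (tent a p b) := by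
      symm
      rw [indicator_eq_self]
      intro x hx
      by_contra hn
      exact hx (tent_eq_zero hap hpb hn)
    rw [this, memLp_indicator_iff_restrict measurableSet_Icc]
    have : IsFiniteMeasure (halfVolume.restrict (Icc a b)) := by
      refine ⟨?_⟩
      rw [Measure.restrict_apply_univ]
      refine (Measure.restrict_apply_le _ _).trans_lt ?_
      simp
    exact MemLp.of_bound (continuous_tent a p b).aestronglyMeasurable 1
      (Eventually.of_forall fun x => by
        rw [Real.norm_of_nonneg (tent_nonneg a p b x)]; exact tent_le_one hap hpb x)
  memLp_deriv := (memLp_indicator_Ioc a p _).sub (memLp_indicator_Ioc p b _)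
  eq_integral x hx := by
    have hi : ∀ a b c : ℝ, IntervalIntegrable ((Ioc a b).indicator fun _ => c) volume 0 x :=
      fun a b c => intervalIntegrable_of_memLp (memLp_indicator_Ioc a b c) le_rfl hx
    simp only [tentDeriv]
    rw [intervalIntegral.integral_sub (hi _ _ _) (hi _ _ _), integral_indicator_Ioc _ ha hx,
      integral_indicator_Ioc _ (ha.trans hap.le) hx]
    have h1 : 0 < p - a := by linarith
    have h2 : 0 < b - p := by linarith
    rcases le_total x p with hxp | hxp
    · rw [min_eq_left hxp, min_eq_left (hxp.trans hpb.le), max_eq_right (by linarith : x - p ≤ 0),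
        tent, min_eq_left]
      · rw [zero_mul, sub_zero, ← div_eq_mul_inv]
        rcases le_total x a with hxa | hxa
        · rw [max_eq_right (by linarith : x - a ≤ 0), max_eq_left
            (div_nonpos_of_nonpos_of_nonneg (by linarith) h1.le), zero_div]
        · rw [max_eq_left (by linarith : 0 ≤ x - a),
            max_eq_right (div_nonneg (by linarith) h1.le)]
      · refine ((div_le_one h1).2 (by linarith)).trans ((one_le_div h2).2 (by linarith))
    · rw [min_eq_right hxp, max_eq_left h1.le, mul_inv_cancel₀ h1.ne', tent, min_eq_right]
      · rcases le_total x b with hxb | hxb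
        · rw [min_eq_left hxb, max_eq_left (by linarith : 0 ≤ x - p),
            max_eq_right (div_nonneg (by linarith) h2.le)]
          field_simp
          ring
        · rw [min_eq_right hxb, max_eq_left h2.le, mul_inv_cancel₀ h2.ne', sub_self, max_eq_left]
          exact div_nonpos_of_nonpos_of_nonneg (by linarith) h2.le
      · refine ((div_le_one h2).2 (by linarith)).trans ((one_le_div h1).2 (by linarith))

theorem setIntegral_mul_indicator_Ioc {g : ℝ → ℝ} (ha : 0 ≤ a) (hab : a ≤ b) (c : ℝ) :
    ∫ x in Ioi 0, g x * (Ioc a b).indicator (fun _ => c) x = (∫ x in a..b, g x) * c := by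
  have : ∀ x, g x * (Ioc a b).indicator (fun _ => c) x
      = (Ioc a b).indicator (fun x => g x * c) x := fun x => by
    by_cases hx : x ∈ Ioc a b <;> simp [hx]
  have hs : Ioc a b ⊆ Ioi 0 := fun x hx => lt_of_le_of_lt ha hx.1
  simp_rw [this]
  rw [setIntegral_indicator measurableSet_Ioc, inter_eq_self_of_subset_right hs,
    integral_mul_const, intervalIntegral.integral_of_le hab]

/-- The derivative of a tent is a two-step function, so pairing with it yields a difference of
slopes of `f`. This turns the weak equation into a statement about chords. -/
theorem IsH1.integral_mul_tentDeriv {f g : ℝ → ℝ} (h : IsH1 f g) (ha : 0 ≤ a) (hap : a < p)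
    (hpb : p < b) : ∫ x in Ioi 0, g x * tentDeriv a p b x
      = (f p - f a) / (p - a) - (f b - f p) / (b - p) := by
  simp only [tentDeriv, mul_sub]
  rw [integral_sub (integrable_mul_of_memLp h.memLp_deriv (memLp_indicator_Ioc _ _ _))
    (integrable_mul_of_memLp h.memLp_deriv (memLp_indicator_Ioc _ _ _)),
    setIntegral_mul_indicator_Ioc ha hap.le, setIntegral_mul_indicator_Ioc (ha.trans hap.le) hpb.le,
    h.sub_eq ha (ha.trans hap.le), h.sub_eq (ha.trans hap.le) (by linarith), div_eq_mul_inv,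
    div_eq_mul_inv]

theorem integral_tentDeriv_sq (ha : 0 ≤ a) (hap : a < p) (hpb : p < b) :
    ∫ x in Ioi 0, tentDeriv a p b x ^ 2 = 1 / (p - a) + 1 / (b - p) := by
  simp_rw [sq]
  have hp : tent a p b p = 1 := by
    rw [tent, div_self (by linarith), div_self (by linarith)]; simp
  have h0 : tent a p b a = 0 := by simp [tent]
  have h1 : tent a p b b = 0 := by simp [tent]
  rw [(isH1_tent ha hap hpb).integral_mul_tentDeriv ha hap hpb, hp, h0, h1]
  ring

/-- On the middle half of its support, of length `h`, the tent is at least `1/2`. -/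
theorem le_integral_tent_sq {h : ℝ} (ha : 0 ≤ a) (hh : 0 < h) :
    h / 4 ≤ ∫ x in Ioi 0, tent a (a + h) (a + 2 * h) x ^ 2 := by
  have hT := isH1_tent ha (by linarith : a < a + h) (by linarith : a + h < a + 2 * h)
  have hs : Icc (a + h / 2) (a + 3 * h / 2) ⊆ Ioi 0 := fun x hx =>
    lt_of_lt_of_le (by positivity) hx.1
  have h1 : ∫ x in Icc (a + h / 2) (a + 3 * h / 2), (1 / 2 : ℝ) ^ 2
      ≤ ∫ x in Icc (a + h / 2) (a + 3 * h / 2), tent a (a + h) (a + 2 * h) x ^ 2 := by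
    refine setIntegral_mono_on (by simp) (hT.integrable_sq.mono_measure
      (Measure.restrict_mono hs le_rfl)) measurableSet_Icc fun x hx => ?_
    refine pow_le_pow_left₀ (by norm_num) (le_max_of_le_right (le_min ?_ ?_)) 2
    · rw [le_div_iff₀ (by linarith)]; linarith [hx.1]
    · rw [le_div_iff₀ (by linarith)]; linarith [hx.2]
  have h2 := setIntegral_mono_set hT.integrable_sq (Eventually.of_forall fun x => sq_nonneg _)
    hs.eventuallyLE
  refine le_trans (le_of_eq ?_) (h1.trans h2)
  rw [setIntegral_const, Measure.real, Real.volume_Icc, ENNReal.toReal_ofReal (by linarith),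
    smul_eq_mul]
  ring

end Tent

/-! ### Variational characterization of the fundamental mode -/

/-- Products of locally integrable functions with continuous functions of compact support. -/
theorem integrable_mul_of_continuousOn {U k : ℝ → ℝ} (hU : LocallyIntegrableOn U (Ioi 0)) {a b : ℝ}
    (ha : 0 < a) (hk : ContinuousOn k (Icc a b)) (h0 : ∀ x, x ∉ Icc a b → k x = 0) :
    Integrable (fun x => U x * k x) halfVolume := by
  have h1 : IntegrableOn (fun x => U x * k x) (Icc a b) :=
    (hU.integrableOn_compact_subset (fun x hx => lt_of_lt_of_le ha hx.1)
      isCompact_Icc).mul_continuousOn hk isCompact_Icc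
  exact h1.of_forall_sdiff_eq_zero measurableSet_Ioi fun x hx => by rw [h0 x hx.2, mul_zero]

theorem IsH1.mem_unitSphere {f g : ℝ → ℝ} (h : IsH1 f g) (h1 : ∫ x in Ioi 0, f x ^ 2 = 1) :
    f ∈ unitSphere := ⟨h.memH10, h1⟩

theorem exists_normalized {f g : ℝ → ℝ} (h : IsH1 f g) (h0 : 0 < ∫ x in Ioi 0, f x ^ 2) :
    ∃ c : ℝ, c ≠ 0 ∧ c ^ 2 * ∫ x in Ioi 0, f x ^ 2 = 1 ∧
      IsH1 (fun x => c * f x) (fun x => c * g x) ∧ ∫ x in Ioi 0, (c * f x) ^ 2 = 1 := by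
  set m := ∫ x in Ioi 0, f x ^ 2
  have hm : (√m)⁻¹ ^ 2 * m = 1 := by
    rw [inv_pow, Real.sq_sqrt h0.le, inv_mul_cancel₀ h0.ne']
  refine ⟨(√m)⁻¹, inv_ne_zero (Real.sqrt_pos.2 h0).ne', hm, h.const_mul _, ?_⟩
  simp_rw [mul_pow]
  rw [integral_const_mul, hm]

theorem integrable_mul_tent {U f : ℝ → ℝ} (hU : LocallyIntegrableOn U (Ioi 0))
    (hf : ContinuousOn f (Ici 0)) {a p b : ℝ} (ha : 0 < a) (hap : a < p) (hpb : p < b) :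
    Integrable (fun x => U x * (f x * tent a p b x)) halfVolume :=
  integrable_mul_of_continuousOn hU ha
    ((hf.mono fun x hx => ha.le.trans hx.1).mul (continuous_tent a p b).continuousOn)
    fun x hx => by rw [tent_eq_zero hap hpb hx, mul_zero]

theorem integrable_mul_tent_sq {U : ℝ → ℝ} (hU : LocallyIntegrableOn U (Ioi 0))
    {a p b : ℝ} (ha : 0 < a) (hap : a < p) (hpb : p < b) :
    Integrable (fun x => U x * tent a p b x ^ 2) halfVolume := by
  simp_rw [sq]
  exact integrable_mul_tent hU (continuous_tent a p b).continuousOn ha hap hpb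

namespace IsAdmissible

variable {U V : ℝ → ℝ}

theorem coe_le_fundamentalMode (hU : IsAdmissible U) {c : ℝ}
    (H : ∀ f g, IsH1 f g → ∫ x in Ioi 0, f x ^ 2 = 1 →
      Integrable (fun x => U x * f x ^ 2) halfVolume →
      c ≤ (∫ x in Ioi 0, g x ^ 2) + ∫ x in Ioi 0, U x * f x ^ 2) :
    (c : EReal) ≤ fundamentalMode U := by
  refine le_iInf₂ fun f hf => ?_
  have h := hf.1.isH1
  by_cases hi : Integrable (fun x => U x * f x ^ 2) halfVolume
  · rw [energy_eq h hi]
    exact EReal.coe_le_coe_iff.2 (H f _ h hf.2 hi)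
  · rw [energy_eq_top hU h hi]
    exact le_top

theorem fundamentalMode_ne_bot (hU : IsAdmissible U) : fundamentalMode U ≠ ⊥ := by
  obtain ⟨C, hC⟩ := hU.bddBelow
  refine ((EReal.bot_lt_coe (-C)).trans_le (hU.coe_le_fundamentalMode fun f g h h1 hi => ?_)).ne'
  have hg : 0 ≤ ∫ x in Ioi 0, g x ^ 2 := integral_nonneg fun x => sq_nonneg _
  have : ∫ x in Ioi 0, -C * f x ^ 2 ≤ ∫ x in Ioi 0, U x * f x ^ 2 := by
    refine integral_mono_ae (h.integrable_sq.const_mul _) hi ?_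
    filter_upwards [hC] with x hx
    exact mul_le_mul_of_nonneg_right hx (sq_nonneg _)
  rw [integral_const_mul, h1] at this
  linarith

/-- A normalized tent supported in `[1, 3]` has finite energy; it must stay away from 0, where the
potential need not be integrable. -/
theorem fundamentalMode_ne_top (hU : IsAdmissible U) : fundamentalMode U ≠ ⊤ := by
  have hT := isH1_tent zero_le_one (by norm_num : (1 : ℝ) < 1 + 1)
    (by norm_num : (1 : ℝ) + 1 < 1 + 2 * 1)
  have h0 := le_integral_tent_sq zero_le_one (one_pos : (0 : ℝ) < 1)
  obtain ⟨c, _, _, hc, h1⟩ := exists_normalized hT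
    (lt_of_lt_of_le (by norm_num) h0)
  have hi : Integrable (fun x => U x * (c * tent 1 (1 + 1) (1 + 2 * 1) x) ^ 2) halfVolume := by
    have := (integrable_mul_tent_sq hU.locallyIntegrableOn one_pos (by norm_num : (1 : ℝ) < 1 + 1)
      (by norm_num : (1 : ℝ) + 1 < 1 + 2 * 1)).const_mul (c ^ 2)
    refine this.congr (Eventually.of_forall fun x => ?_)
    simp only
    ring
  refine ((iInf₂_le _ (hc.mem_unitSphere h1)).trans_lt ?_).ne
  rw [energy_eq hc hi]
  exact EReal.coe_lt_top _

theorem coe_toReal (hU : IsAdmissible U) :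
    ((fundamentalMode U).toReal : EReal) = fundamentalMode U :=
  EReal.coe_toReal hU.fundamentalMode_ne_top hU.fundamentalMode_ne_bot

/-- The homogeneous form of the variational inequality, which avoids normalizing test functions in
later perturbation arguments. -/
theorem toReal_mul_le (hU : IsAdmissible U) {f g : ℝ → ℝ} (h : IsH1 f g)
    (hi : Integrable (fun x => U x * f x ^ 2) halfVolume) :
    (fundamentalMode U).toReal * ∫ x in Ioi 0, f x ^ 2
      ≤ (∫ x in Ioi 0, g x ^ 2) + ∫ x in Ioi 0, U x * f x ^ 2 := by
  have hnn : 0 ≤ ∫ x in Ioi 0, f x ^ 2 := integral_nonneg fun x => sq_nonneg _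
  rcases hnn.eq_or_lt with h0 | h0
  · have hz := (integral_eq_zero_iff_of_nonneg (fun x => sq_nonneg _) h.integrable_sq).1 h0.symm
    have : ∫ x in Ioi 0, U x * f x ^ 2 = 0 := by
      refine integral_eq_zero_of_ae ?_
      filter_upwards [hz] with x hx
      rw [show f x ^ 2 = 0 from hx]; simp
    rw [← h0, this, mul_zero, add_zero]
    exact integral_nonneg fun x => sq_nonneg _
  · obtain ⟨c, hc0, hcm, hc, h1⟩ := exists_normalized h h0
    have he : ∀ x, U x * (c * f x) ^ 2 = c ^ 2 * (U x * f x ^ 2) := fun x => by ring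
    have hi' : Integrable (fun x => U x * (c * f x) ^ 2) halfVolume := by
      simp_rw [he]; exact hi.const_mul _
    have hle : fundamentalMode U ≤ energy U fun x => c * f x :=
      iInf₂_le _ (hc.mem_unitSphere h1)
    rw [energy_eq hc hi', ← hU.coe_toReal, EReal.coe_le_coe_iff] at hle
    simp_rw [he, mul_pow] at hle
    rw [integral_const_mul, integral_const_mul] at hle
    have hc2 : 0 < c ^ 2 := by positivity
    refine le_of_mul_le_mul_left ?_ hc2
    calc c ^ 2 * ((fundamentalMode U).toReal * ∫ x in Ioi 0, f x ^ 2)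
        = (fundamentalMode U).toReal * (c ^ 2 * ∫ x in Ioi 0, f x ^ 2) := by ring
      _ ≤ _ := by rw [hcm, mul_one]; linarith

theorem toReal_le (hU : IsAdmissible U) {f g : ℝ → ℝ} (h : IsH1 f g)
    (h1 : ∫ x in Ioi 0, f x ^ 2 = 1) (hi : Integrable (fun x => U x * f x ^ 2) halfVolume) :
    (fundamentalMode U).toReal ≤ (∫ x in Ioi 0, g x ^ 2) + ∫ x in Ioi 0, U x * f x ^ 2 := by
  simpa [h1] using hU.toReal_mul_le h hi

theorem le_toReal (hU : IsAdmissible U) {c : ℝ}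
    (H : ∀ f g, IsH1 f g → ∫ x in Ioi 0, f x ^ 2 = 1 →
      Integrable (fun x => U x * f x ^ 2) halfVolume →
      c ≤ (∫ x in Ioi 0, g x ^ 2) + ∫ x in Ioi 0, U x * f x ^ 2) :
    c ≤ (fundamentalMode U).toReal := by
  have := hU.coe_le_fundamentalMode H
  rwa [← hU.coe_toReal, EReal.coe_le_coe_iff] at this

theorem exists_lt (hU : IsAdmissible U) {ε : ℝ} (hε : 0 < ε) :
    ∃ f g, IsH1 f g ∧ ∫ x in Ioi 0, f x ^ 2 = 1 ∧
      Integrable (fun x => U x * f x ^ 2) halfVolume ∧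
      (∫ x in Ioi 0, g x ^ 2) + ∫ x in Ioi 0, U x * f x ^ 2
        < (fundamentalMode U).toReal + ε := by
  by_contra! H
  have := hU.le_toReal H
  linarith

/-- A wide tent far away from the origin shows that the fundamental mode is at most the upper
limit of the potential. -/
theorem toReal_le_of_eventually (hU : IsAdmissible U) {c R : ℝ}
    (h : ∀ᵐ x ∂halfVolume, R ≤ x → U x ≤ c) : (fundamentalMode U).toReal ≤ c := by
  refine le_of_forall_pos_le_add fun ε hε => ?_
  set a := max R 1
  have ha : 0 < a := lt_of_lt_of_le one_pos (le_max_right _ _)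
  -- A tent of half-width `s` has kinetic energy `2/s` and mass at least `s/4`; the quotient is then
  -- at most `8/s² = ε`.
  set s := √(8 / ε)
  have hs : 0 < s := Real.sqrt_pos.2 (by positivity)
  have hs2 : s ^ 2 = 8 / ε := Real.sq_sqrt (by positivity)
  have hT := isH1_tent ha.le (by linarith : a < a + s) (by linarith : a + s < a + 2 * s)
  have hi := integrable_mul_tent_sq hU.locallyIntegrableOn ha (by linarith : a < a + s)
    (by linarith : a + s < a + 2 * s)
  have h1 := hU.toReal_mul_le hT hi
  have h2 : ∫ x in Ioi 0, U x * tent a (a + s) (a + 2 * s) x ^ 2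
      ≤ c * ∫ x in Ioi 0, tent a (a + s) (a + 2 * s) x ^ 2 := by
    rw [← integral_const_mul]
    refine integral_mono_ae hi (hT.integrable_sq.const_mul c) ?_
    filter_upwards [h] with x hx
    by_cases hxa : x ∈ Icc a (a + 2 * s)
    · exact mul_le_mul_of_nonneg_right (hx ((le_max_left _ _).trans hxa.1)) (sq_nonneg _)
    · simp [tent_eq_zero (by linarith : a < a + s) (by linarith : a + s < a + 2 * s) hxa]
  have h3 := le_integral_tent_sq ha.le hs
  rw [integral_tentDeriv_sq ha.le (by linarith) (by linarith)] at h1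
  set m := ∫ x in Ioi 0, tent a (a + s) (a + 2 * s) x ^ 2
  have hm : 0 < m := by linarith
  have h4 : 1 / (a + s - a) + 1 / (a + 2 * s - (a + s)) = 2 / s := by
    rw [show a + s - a = s by ring, show a + 2 * s - (a + s) = s by ring]; ring
  rw [h4] at h1
  have h5 : 2 / s ≤ ε * m := by
    have h6 : 2 / s = ε * (s / 4) := by
      rw [div_eq_iff hs.ne']
      have : ε * s ^ 2 = 8 := by rw [hs2]; field_simp
      nlinarith
    rw [h6]
    exact mul_le_mul_of_nonneg_left h3 hε.le
  refine le_of_mul_le_mul_right ?_ hm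
  linarith

end IsAdmissible

/-! ### Upper limit, monotonicity and concavity -/

theorem exists_ae_of_eventually_essAtTop {p : ℝ → Prop} (h : ∀ᶠ x in essAtTop, p x) :
    ∃ R : ℝ, ∀ᵐ x ∂halfVolume, R ≤ x → p x := by
  rw [essAtTop, Filter.eventually_inf] at h
  obtain ⟨s, hs, t, ht, H⟩ := h
  obtain ⟨R, hR⟩ := mem_atTop_sets.1 hs
  refine ⟨R, ae_restrict_of_ae ?_⟩
  filter_upwards [ht] with x hx hxR using H x ⟨hR x hxR, hx⟩

theorem fundamentalMode_le_limsup {U : ℝ → ℝ} (hU : IsAdmissible U) :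
    fundamentalMode U ≤ limsup (fun ξ => (U ξ : EReal)) essAtTop := by
  rw [← hU.coe_toReal]
  refine le_of_forall_gt fun y hy => ?_
  obtain ⟨c, hc, hcy⟩ := EReal.lt_iff_exists_real_btwn.1 hy
  obtain ⟨R, hR⟩ := exists_ae_of_eventually_essAtTop (eventually_lt_of_limsup_lt hc)
  refine lt_of_le_of_lt
    (EReal.coe_le_coe_iff.2 (hU.toReal_le_of_eventually (c := c) (R := R) ?_)) hcy
  filter_upwards [hR] with x hx hxR
  exact_mod_cast (hx hxR).le

theorem IsPotential.toReal_nonneg {U : ℝ → ℝ} (hU : IsPotential U) :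
    0 ≤ (fundamentalMode U).toReal :=
  hU.isAdmissible.le_toReal fun f g _ _ _ => add_nonneg (integral_nonneg fun x => sq_nonneg _)
    (integral_nonneg_of_ae (by
      filter_upwards [hU.nonneg] with x hx using mul_nonneg hx (sq_nonneg _)))

theorem IsPotential.integrable_of_le {U V f : ℝ → ℝ} (hU : IsPotential U)
    (hle : ∀ᵐ ξ ∂halfVolume, U ξ ≤ V ξ) (hf : AEStronglyMeasurable f halfVolume)
    (hi : Integrable (fun x => V x * f x ^ 2) halfVolume) :
    Integrable (fun x => U x * f x ^ 2) halfVolume := by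
  refine hi.mono (hU.isAdmissible.aestronglyMeasurable.mul (hf.pow 2)) ?_
  filter_upwards [hU.nonneg, hle] with x hx hx'
  rw [Real.norm_of_nonneg (mul_nonneg hx (sq_nonneg _)),
    Real.norm_of_nonneg (mul_nonneg (hx.trans hx') (sq_nonneg _))]
  exact mul_le_mul_of_nonneg_right hx' (sq_nonneg _)

theorem fundamentalMode_mono {U V : ℝ → ℝ} (hU : IsPotential U) (hV : IsPotential V)
    (hle : ∀ᵐ ξ ∂halfVolume, U ξ ≤ V ξ) : fundamentalMode U ≤ fundamentalMode V := by
  rw [← hU.isAdmissible.coe_toReal, ← hV.isAdmissible.coe_toReal, EReal.coe_le_coe_iff]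
  refine hV.isAdmissible.le_toReal fun f g h h1 hi => ?_
  have hi' := hU.integrable_of_le hle h.memLp.aestronglyMeasurable hi
  refine (hU.isAdmissible.toReal_le h h1 hi').trans ?_
  refine add_le_add le_rfl (integral_mono_ae hi' hi ?_)
  filter_upwards [hle] with x hx using mul_le_mul_of_nonneg_right hx (sq_nonneg _)

theorem IsPotential.const_mul {U : ℝ → ℝ} (hU : IsPotential U) {a : ℝ} (ha : 0 ≤ a) :
    IsPotential (a • U) :=
  ⟨hU.locallyIntegrableOn.smul a, by
    filter_upwards [hU.nonneg] with x hx using mul_nonneg ha hx⟩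

theorem IsPotential.add {U V : ℝ → ℝ} (hU : IsPotential U) (hV : IsPotential V) :
    IsPotential (U + V) :=
  ⟨hU.locallyIntegrableOn.add hV.locallyIntegrableOn, by
    filter_upwards [hU.nonneg, hV.nonneg] with x hx hx' using add_nonneg hx hx'⟩

theorem concaveOn_fundamentalMode :
    ConcaveOn ℝ {U : ℝ → ℝ | IsPotential U} (fun U => (fundamentalMode U).toReal) := by
  refine ⟨fun U hU V hV a b ha hb _ => (hU.const_mul ha).add (hV.const_mul hb),
    fun U hU V hV a b ha hb hab => ?_⟩
  replace hU : IsPotential U := hU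
  replace hV : IsPotential V := hV
  have hUa := hU.const_mul ha
  have hVb := hV.const_mul hb
  refine (hUa.add hVb).isAdmissible.le_toReal fun f g h h1 hi => ?_
  have e : ∀ x, (a • U + b • V) x * f x ^ 2 = (a • U) x * f x ^ 2 + (b • V) x * f x ^ 2 :=
    fun x => add_mul _ _ _
  have i1 : Integrable (fun x => (a • U) x * f x ^ 2) halfVolume := by
    refine hUa.integrable_of_le ?_ h.memLp.aestronglyMeasurable hi
    filter_upwards [hVb.nonneg] with x hx using le_add_of_nonneg_right hx
  have i2 : Integrable (fun x => (b • V) x * f x ^ 2) halfVolume := by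
    refine hVb.integrable_of_le ?_ h.memLp.aestronglyMeasurable hi
    filter_upwards [hUa.nonneg] with x hx using le_add_of_nonneg_left hx
  -- A zero weight is treated separately: integrability of the weighted potential term then says
  -- nothing about `W` itself.
  have key : ∀ (W : ℝ → ℝ), IsPotential W → ∀ s : ℝ, 0 ≤ s →
      Integrable (fun x => (s • W) x * f x ^ 2) halfVolume →
      s * (fundamentalMode W).toReal
        ≤ s * (∫ x in Ioi 0, g x ^ 2) + ∫ x in Ioi 0, (s • W) x * f x ^ 2 := by
    intro W hW s hs hi
    rcases hs.eq_or_lt with rfl | hs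
    · simp
    have e : ∀ x, (s • W) x * f x ^ 2 = s * (W x * f x ^ 2) := fun x => by
      simp only [Pi.smul_apply, smul_eq_mul]; ring
    simp_rw [e] at hi ⊢
    rw [integral_const_mul, ← mul_add]
    refine mul_le_mul_of_nonneg_left (hW.isAdmissible.toReal_le h h1 ?_) hs.le
    exact (integrable_const_mul_iff (IsUnit.mk0 s hs.ne') _).1 hi
  simp_rw [e]
  rw [integral_add i1 i2]
  have k1 := key U hU a ha i1
  have k2 := key V hV b hb i2
  have : (∫ x in Ioi 0, g x ^ 2) = a * (∫ x in Ioi 0, g x ^ 2) + b * ∫ x in Ioi 0, g x ^ 2 := by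
    rw [← add_mul, hab, one_mul]
  simp only [smul_eq_mul]
  linarith

/-! ### Continuity in the uniformly local distance -/

theorem ulocDist_comm (U V : ℝ → ℝ) : ulocDist U V = ulocDist V U := by
  simp only [ulocDist, abs_sub_comm]

/-- Functions in `H^1_0(ℝ⁺)` are multipliers for the uniformly local `L¹` distance. -/
theorem IsH1.lintegral_mul_sq_le {U V f g : ℝ → ℝ} (h : IsH1 f g) {δ : ℝ} (hδ : 0 ≤ δ)
    (hd : ulocDist V U ≤ ENNReal.ofReal δ) :
    ∫⁻ x in Ioi 0, ENNReal.ofReal (|V x - U x| * f x ^ 2) ≤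
      ENNReal.ofReal (2 * δ * ((∫ x in Ioi 0, f x ^ 2) + ∫ x in Ioi 0, g x ^ 2)) := by
  have hcover : (⋃ n : ℕ, Ioc (n : ℝ) ((n + 1 : ℕ) : ℝ)) = Ioi 0 := by
    ext x
    simp only [mem_iUnion, mem_Ioi]
    constructor
    · rintro ⟨n, hn⟩
      exact lt_of_le_of_lt (Nat.cast_nonneg n) hn.1
    · intro hx
      have hc : 0 < ⌈x⌉₊ := Nat.ceil_pos.2 hx
      refine ⟨⌈x⌉₊ - 1, ?_, ?_⟩
      · rw [← Nat.lt_ceil]; omega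
      · rw [Nat.sub_add_cancel hc]; exact Nat.le_ceil x
  have hdisj : Pairwise (Function.onFun Disjoint
      fun n : ℕ => Ioc (n : ℝ) ((n + 1 : ℕ) : ℝ)) :=
    (Nat.mono_cast (α := ℝ)).pairwise_disjoint_on_Ioc_succ
  have hu : ∀ F : ℝ → ℝ≥0∞, ∫⁻ x in Ioi 0, F x
      = ∑' n : ℕ, ∫⁻ x in Ioc (n : ℝ) ((n + 1 : ℕ) : ℝ), F x := by
    intro F
    rw [← hcover, lintegral_iUnion (fun n => measurableSet_Ioc) hdisj]
  set k : ℝ → ℝ := fun x => 2 * (f x ^ 2 + g x ^ 2)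
  have hk : Integrable k halfVolume := (h.integrable_sq.add h.integrable_deriv_sq).const_mul 2
  have hk0 : ∀ x, 0 ≤ k x := fun x => by positivity
  -- On each unit interval `f²` is bounded by the integral of `k` over that same interval; hence the
  -- local estimates can be summed.
  have hloc : ∀ n : ℕ,
      ∫⁻ x in Ioc (n : ℝ) ((n + 1 : ℕ) : ℝ), ENNReal.ofReal (|V x - U x| * f x ^ 2)
      ≤ ENNReal.ofReal δ * ∫⁻ x in Ioc (n : ℝ) ((n + 1 : ℕ) : ℝ), ENNReal.ofReal (k x) := by
    intro n
    have hn : (0 : ℝ) ≤ n := Nat.cast_nonneg n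
    rw [Nat.cast_add_one]
    have hs : Ioc (n : ℝ) (n + 1) ⊆ Ioi 0 := fun x hx => lt_of_le_of_lt hn hx.1
    have hki : IntegrableOn k (Ioc (n : ℝ) (n + 1)) :=
      hk.mono_measure (Measure.restrict_mono hs le_rfl)
    have hsum : ∫ x in Ioc (n : ℝ) (n + 1), k x = 2 * ((∫ t in Ioc (n : ℝ) (n + 1), f t ^ 2)
        + ∫ t in Ioc (n : ℝ) (n + 1), g t ^ 2) := by
      simp only [k]
      rw [integral_const_mul, integral_add
        (h.integrable_sq.mono_measure (Measure.restrict_mono hs le_rfl))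
        (h.integrable_deriv_sq.mono_measure (Measure.restrict_mono hs le_rfl))]
    rw [← ofReal_integral_eq_lintegral_ofReal hki (Eventually.of_forall hk0)]
    calc ∫⁻ x in Ioc (n : ℝ) (n + 1), ENNReal.ofReal (|V x - U x| * f x ^ 2)
        ≤ ∫⁻ x in Ioc (n : ℝ) (n + 1), ENNReal.ofReal |V x - U x| *
            ENNReal.ofReal (∫ x in Ioc (n : ℝ) (n + 1), k x) := by
          refine setLIntegral_mono' measurableSet_Ioc fun x hx => ?_
          rw [ENNReal.ofReal_mul (abs_nonneg _)]
          gcongr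
          rw [hsum]
          exact h.sq_le_local hn (Ioc_subset_Icc_self hx)
      _ = (∫⁻ x in Ioc (n : ℝ) (n + 1), ENNReal.ofReal |V x - U x|) *
            ENNReal.ofReal (∫ x in Ioc (n : ℝ) (n + 1), k x) :=
          lintegral_mul_const' _ _ ENNReal.ofReal_ne_top
      _ ≤ _ := by
          gcongr
          exact (le_iSup₂ (f := fun (a : ℝ) (_ : a ∈ Ici (0 : ℝ)) =>
            ∫⁻ ξ in Ioc a (a + 1), ENNReal.ofReal |V ξ - U ξ|) (n : ℝ) hn).trans hd
  rw [hu]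
  refine (ENNReal.tsum_le_tsum hloc).trans (le_of_eq ?_)
  rw [ENNReal.tsum_mul_left, ← hu, ← ofReal_integral_eq_lintegral_ofReal hk
    (Eventually.of_forall hk0), ← ENNReal.ofReal_mul hδ]
  congr 1
  simp only [k]
  rw [integral_const_mul, integral_add h.integrable_sq h.integrable_deriv_sq]
  ring

/-- Replacing `U` by `V` changes the energy of a normalized `f` by at most `2δ(1 + ∫ f'²)`. Since `U
≥ 0`, the kinetic term is bounded by the energy for `U`. -/
theorem IsPotential.toReal_le_of_ulocDist_le {U V : ℝ → ℝ} (hU : IsPotential U)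
    (hV : IsPotential V) {δ : ℝ} (hδ : 0 ≤ δ) (hd : ulocDist V U ≤ ENNReal.ofReal δ) :
    (fundamentalMode V).toReal ≤ (1 + 2 * δ) * (fundamentalMode U).toReal + 2 * δ := by
  have h0 : 0 < 1 + 2 * δ := by positivity
  suffices H : ((fundamentalMode V).toReal - 2 * δ) / (1 + 2 * δ) ≤ (fundamentalMode U).toReal by
    rw [div_le_iff₀ h0] at H
    linarith
  refine hU.isAdmissible.le_toReal fun f g h h1 hi => ?_
  rw [div_le_iff₀ h0]
  have hle := h.lintegral_mul_sq_le hδ hd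
  rw [h1] at hle
  have hm : AEStronglyMeasurable (fun x => (V x - U x) * f x ^ 2) halfVolume :=
    (hV.isAdmissible.aestronglyMeasurable.sub hU.isAdmissible.aestronglyMeasurable).mul
      h.integrable_sq.aestronglyMeasurable
  have hnorm : ∀ x, ‖(V x - U x) * f x ^ 2‖ = |V x - U x| * f x ^ 2 := fun x => by
    rw [norm_mul, Real.norm_eq_abs, Real.norm_of_nonneg (sq_nonneg _)]
  have hdi : Integrable (fun x => (V x - U x) * f x ^ 2) halfVolume := by
    refine ⟨hm, ?_⟩
    rw [hasFiniteIntegral_iff_norm]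
    simp_rw [hnorm]
    exact hle.trans_lt ENNReal.ofReal_lt_top
  have hg : 0 ≤ ∫ x in Ioi 0, g x ^ 2 := integral_nonneg fun x => sq_nonneg _
  have hUf : 0 ≤ ∫ x in Ioi 0, U x * f x ^ 2 := integral_nonneg_of_ae (by
    filter_upwards [hU.nonneg] with x hx using mul_nonneg hx (sq_nonneg _))
  have hdle : ∫ x in Ioi 0, (V x - U x) * f x ^ 2 ≤ 2 * δ * (1 + ∫ x in Ioi 0, g x ^ 2) := by
    refine (Real.le_norm_self _).trans ((norm_integral_le_integral_norm _).trans ?_)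
    simp_rw [hnorm]
    rw [← ofReal_integral_eq_lintegral_ofReal (by simpa only [hnorm] using hdi.norm)
      (Eventually.of_forall fun x => by positivity)] at hle
    exact (ENNReal.ofReal_le_ofReal_iff (by positivity)).1 hle
  have e : ∀ x, V x * f x ^ 2 = U x * f x ^ 2 + (V x - U x) * f x ^ 2 := fun x => by ring
  have hVi : Integrable (fun x => V x * f x ^ 2) halfVolume := by
    simp_rw [e]; exact hi.add hdi
  have := hV.isAdmissible.toReal_le h h1 hVi
  simp_rw [e] at this
  rw [integral_add hi hdi] at this
  nlinarith [mul_nonneg hδ hUf]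

theorem IsPotential.exists_ulocDist_bound {U : ℝ → ℝ} (hU : IsPotential U) {ε : ℝ} (hε : 0 < ε) :
    ∃ δ : ℝ, 0 < δ ∧ ∀ V : ℝ → ℝ, IsPotential V → ulocDist V U ≤ ENNReal.ofReal δ →
      |(fundamentalMode V).toReal - (fundamentalMode U).toReal| ≤ ε := by
  set E := (fundamentalMode U).toReal with hE
  have hE0 : 0 ≤ E := hU.toReal_nonneg
  -- The bound `δ ≤ 1/2` keeps the mode of `V` below `2E + 1`, so both one-sided deviations are at
  -- most `4δ(E + 1)`, which the second bound makes at most `ε`.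
  refine ⟨min (1 / 2) (ε / (4 * (E + 1))), by positivity, fun V hV hd => ?_⟩
  set δ := min (1 / 2) (ε / (4 * (E + 1)))
  have hδ : 0 ≤ δ := by positivity
  have h2 : δ ≤ 1 / 2 := min_le_left _ _
  have h3 : 4 * δ * (E + 1) ≤ ε := by
    have : δ ≤ ε / (4 * (E + 1)) := min_le_right _ _
    rw [le_div_iff₀ (by positivity)] at this
    linarith
  have k1 := hU.toReal_le_of_ulocDist_le hV hδ hd
  have k2 := hV.toReal_le_of_ulocDist_le hU hδ (by rwa [ulocDist_comm])
  rw [← hE] at k1 k2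
  have hp : 0 ≤ δ * (E + 1) := by positivity
  have hVn := hV.toReal_nonneg
  have k3 : δ * (fundamentalMode V).toReal ≤ δ * (E + (E + 1)) :=
    mul_le_mul_of_nonneg_left (by nlinarith) hδ
  rw [abs_le]
  constructor <;> nlinarith

/-! ### Scaling for the square root potential -/

/-- Dilations of functions in `H^1_0(ℝ⁺)`. -/
theorem IsH1.comp_mul_left {f g : ℝ → ℝ} (h : IsH1 f g) {c : ℝ} (hc : 0 < c) :
    IsH1 (fun x => f (c * x)) (fun x => c * g (c * x)) := by
  have hq : Measure.QuasiMeasurePreserving (fun x : ℝ => c * x) halfVolume halfVolume := by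
    refine Measure.QuasiMeasurePreserving.restrict ⟨by fun_prop, ?_⟩
      fun x hx => mul_pos hc hx
    rw [Real.map_volume_mul_left hc.ne']
    exact Measure.smul_absolutelyContinuous
  have hL : ∀ u : ℝ → ℝ, MemLp u 2 halfVolume → MemLp (fun x => u (c * x)) 2 halfVolume := by
    intro u hu
    refine (memLp_two_iff_integrable_sq
      (hu.aestronglyMeasurable.comp_quasiMeasurePreserving hq)).2 ?_
    have := (integrableOn_Ioi_comp_mul_left_iff (fun x => u x ^ 2) 0 hc).2
      (by rw [mul_zero]; exact hu.integrable_sq)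
    exact this
  refine ⟨hL f h.memLp, (hL g h.memLp_deriv).const_mul c, fun x hx => ?_⟩
  rw [intervalIntegral.integral_const_mul, intervalIntegral.integral_comp_mul_left _ hc.ne',
    mul_zero, smul_eq_mul, ← mul_assoc, mul_inv_cancel₀ hc.ne', one_mul]
  exact h.eq_integral _ (by positivity)

theorem isPotential_mul_sqrt {α : ℝ} (hα : 0 ≤ α) : IsPotential fun ξ => α * √ξ :=
  ⟨((by fun_prop : Continuous fun ξ : ℝ => α * √ξ).locallyIntegrable).locallyIntegrableOn _,
    Eventually.of_forall fun _ => by positivity⟩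

/-- Under the dilation by `c = β^(2/5)` the kinetic term scales by `c²` and the potential term by `β
c^(-1/2)`, relative to the mass. These factors agree because `β = c^(5/2)`. -/
theorem toReal_fundamentalMode_mul_sqrt_le {α β : ℝ} (hα : 0 ≤ α) (hβ : 0 < β) :
    (fundamentalMode fun ξ => β * α * √ξ).toReal
      ≤ β ^ (4 / 5 : ℝ) * (fundamentalMode fun ξ => α * √ξ).toReal := by
  set c := β ^ (2 / 5 : ℝ)
  have hc : 0 < c := Real.rpow_pos_of_pos hβ _
  have hc2 : β ^ (4 / 5 : ℝ) = c ^ 2 := by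
    rw [← Real.rpow_natCast, ← Real.rpow_mul hβ.le]; norm_num
  have hc3 : β = c ^ 2 * √c := by
    rw [Real.sqrt_eq_rpow, ← Real.rpow_natCast, ← Real.rpow_mul hβ.le, ← Real.rpow_mul hβ.le,
      ← Real.rpow_add hβ]
    norm_num
  have hsc : 0 < √c := Real.sqrt_pos.2 hc
  rw [hc2, ← div_le_iff₀' (by positivity)]
  refine (isPotential_mul_sqrt hα).isAdmissible.le_toReal fun f g h h1 hi => ?_
  have hF := h.comp_mul_left hc
  have e : ∀ x, β * α * √x * f (c * x) ^ 2 = c ^ 2 * (α * √(c * x) * f (c * x) ^ 2) := by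
    intro x
    rw [Real.sqrt_mul hc.le]
    nth_rewrite 1 [hc3]
    ring
  have hi' : Integrable (fun x => β * α * √x * f (c * x) ^ 2) halfVolume := by
    simp_rw [e]
    refine Integrable.const_mul ?_ _
    have := (integrableOn_Ioi_comp_mul_left_iff (fun x => α * √x * f x ^ 2) 0 hc).2
      (by rw [mul_zero]; exact hi)
    exact this
  have key := (isPotential_mul_sqrt (mul_nonneg hβ.le hα)).isAdmissible.toReal_mul_le hF hi'
  simp_rw [e, mul_pow] at key
  rw [integral_const_mul, integral_const_mul,
    integral_comp_mul_left_Ioi (fun x => f x ^ 2) 0 hc,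
    integral_comp_mul_left_Ioi (fun x => g x ^ 2) 0 hc,
    integral_comp_mul_left_Ioi (fun x => α * √x * f x ^ 2) 0 hc, mul_zero, h1] at key
  simp only [smul_eq_mul, mul_one] at key
  rw [div_le_iff₀ (by positivity)]
  have k2 := mul_le_mul_of_nonneg_left key hc.le
  field_simp at k2
  linarith

theorem fundamentalMode_mul_sqrt {α : ℝ} (hα : 0 < α) :
    fundamentalMode (fun ξ => α * √ξ) =
      ((α ^ (4 / 5 : ℝ) : ℝ) : EReal) * fundamentalMode (fun ξ => √ξ) := by
  have e1 := toReal_fundamentalMode_mul_sqrt_le zero_le_one hα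
  -- The inverse dilation supplies the opposite inequality.
  have e2 := toReal_fundamentalMode_mul_sqrt_le hα.le (inv_pos.2 hα)
  simp only [mul_one, one_mul, inv_mul_cancel₀ hα.ne'] at e1 e2
  have hA := (isPotential_mul_sqrt hα.le).isAdmissible
  have h1 := (isPotential_mul_sqrt zero_le_one).isAdmissible
  simp only [one_mul] at h1
  rw [← hA.coe_toReal, ← h1.coe_toReal, ← EReal.coe_mul, EReal.coe_eq_coe_iff]
  refine le_antisymm e1 ?_
  have hp : 0 < α ^ (4 / 5 : ℝ) := Real.rpow_pos_of_pos hα _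
  rw [Real.inv_rpow hα.le, inv_mul_eq_div, le_div_iff₀ hp] at e2
  linarith

/-! ### Weak compactness and lower semicontinuity -/

/-- Bounded sequences in `L²` have weakly convergent subsequences. -/
theorem exists_subseq_tendsto_integral_mul {G : ℕ → ℝ → ℝ} (hG : ∀ n, MemLp (G n) 2 halfVolume)
    {C : ℝ} (hC : ∀ n, ∫ x in Ioi 0, G n x ^ 2 ≤ C) :
    ∃ g : ℝ → ℝ, MemLp g 2 halfVolume ∧ ∃ ms : ℕ → ℕ, StrictMono ms ∧
      ∀ k : ℝ → ℝ, MemLp k 2 halfVolume →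
        Tendsto (fun n => ∫ x in Ioi 0, G (ms n) x * k x) atTop (𝓝 (∫ x in Ioi 0, g x * k x)) := by
  let φ : ℕ → WeakDual ℝ (Lp ℝ 2 halfVolume) := fun n =>
    StrongDual.toWeakDual (InnerProductSpace.toDual ℝ (Lp ℝ 2 halfVolume) ((hG n).toLp (G n)))
  have hinner : ∀ (u v : ℝ → ℝ) (hu : MemLp u 2 halfVolume) (hv : MemLp v 2 halfVolume),
      inner ℝ (hu.toLp u) (hv.toLp v) = ∫ x in Ioi 0, u x * v x := by
    intro u v hu hv
    rw [L2.inner_def]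
    refine integral_congr_ae ?_
    filter_upwards [hu.coeFn_toLp, hv.coeFn_toLp] with x hx hx'
    rw [hx, hx']
    simp [mul_comm]
  have hmem : ∀ n, φ n ∈ WeakDual.toStrongDual ⁻¹' Metric.closedBall
      (0 : StrongDual ℝ (Lp ℝ 2 halfVolume)) √C := by
    intro n
    have hn : ‖(hG n).toLp (G n)‖ ≤ √C := by
      refine Real.le_sqrt_of_sq_le ?_
      rw [← real_inner_self_eq_norm_sq, hinner]
      simpa only [sq] using hC n
    simpa [φ] using hn
  have hfact : Fact ((2 : ℝ≥0∞) ≠ ⊤) := ⟨by norm_num⟩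
  have hsep : TopologicalSpace.SeparableSpace (Lp ℝ 2 halfVolume) :=
    @TopologicalSpace.SecondCountableTopology.to_separableSpace _ _ Lp.SecondCountableTopology
  -- Sequential Banach-Alaoglu, using separability of `L²`; the Riesz isomorphism turns the limit
  -- functional back into a function.
  obtain ⟨ψ, _, ms, hms, hlim⟩ := WeakDual.isSeqCompact_closedBall ℝ (Lp ℝ 2 halfVolume) 0 √C hmem
  set y := (InnerProductSpace.toDual ℝ (Lp ℝ 2 halfVolume)).symm (WeakDual.toStrongDual ψ)
  refine ⟨y, Lp.memLp y, ms, hms, fun k hk => ?_⟩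
  have h1 := ((WeakDual.eval_continuous (hk.toLp k)).tendsto ψ).comp hlim
  have h2 : ψ (hk.toLp k) = ∫ x in Ioi 0, y x * k x := by
    have : ψ (hk.toLp k) = inner ℝ y (hk.toLp k) := by
      rw [← InnerProductSpace.toDual_apply_apply (𝕜 := ℝ), LinearIsometryEquiv.apply_symm_apply]
      rfl
    rw [this]
    conv_lhs => rw [← Lp.toLp_coeFn y (Lp.memLp y)]
    exact hinner _ _ _ _
  rw [h2] at h1
  refine h1.congr fun n => ?_
  exact hinner _ _ _ _

/-- Fatou's lemma for Bochner integrals of nonnegative functions. -/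
theorem integrable_and_integral_le_of_tendsto {u : ℕ → ℝ → ℝ} {v : ℝ → ℝ}
    (hu : ∀ n, Integrable (u n) halfVolume) (h0 : ∀ n, ∀ᵐ x ∂halfVolume, 0 ≤ u n x)
    (hlim : ∀ᵐ x ∂halfVolume, Tendsto (fun n => u n x) atTop (𝓝 (v x))) {a : ℕ → ℝ} {b : ℝ}
    (ha : ∀ n, ∫ x in Ioi 0, u n x ≤ a n) (hab : Tendsto a atTop (𝓝 b)) :
    Integrable v halfVolume ∧ ∫ x in Ioi 0, v x ≤ b := by
  have hv0 : ∀ᵐ x ∂halfVolume, 0 ≤ v x := by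
    filter_upwards [hlim, ae_all_iff.2 h0] with x hx hx0
    exact ge_of_tendsto' hx hx0
  have hvm : AEStronglyMeasurable v halfVolume :=
    aestronglyMeasurable_of_tendsto_ae atTop (fun n => (hu n).aestronglyMeasurable) hlim
  have hb0 : 0 ≤ b := ge_of_tendsto' hab fun n =>
    (integral_nonneg_of_ae (h0 n)).trans (ha n)
  have key : ∫⁻ x in Ioi 0, ENNReal.ofReal (v x) ≤ ENNReal.ofReal b := by
    calc ∫⁻ x in Ioi 0, ENNReal.ofReal (v x)
        = ∫⁻ x in Ioi 0, liminf (fun n => ENNReal.ofReal (u n x)) atTop := by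
          refine lintegral_congr_ae ?_
          filter_upwards [hlim] with x hx
          exact ((ENNReal.continuous_ofReal.tendsto _).comp hx).liminf_eq.symm
      _ ≤ liminf (fun n => ∫⁻ x in Ioi 0, ENNReal.ofReal (u n x)) atTop :=
          lintegral_liminf_le' fun n => (hu n).aestronglyMeasurable.aemeasurable.ennreal_ofReal
      _ ≤ liminf (fun n => ENNReal.ofReal (a n)) atTop := by
          refine liminf_le_liminf (Eventually.of_forall fun n => ?_)
          rw [← ofReal_integral_eq_lintegral_ofReal (hu n) (h0 n)]
          exact ENNReal.ofReal_le_ofReal (ha n)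
      _ = ENNReal.ofReal b := ((ENNReal.continuous_ofReal.tendsto _).comp hab).liminf_eq
  have hvi : Integrable v halfVolume := by
    refine ⟨hvm, ?_⟩
    rw [hasFiniteIntegral_iff_ofReal hv0]
    exact key.trans_lt ENNReal.ofReal_lt_top
  refine ⟨hvi, ?_⟩
  rw [← ofReal_integral_eq_lintegral_ofReal hvi hv0] at key
  exact (ENNReal.ofReal_le_ofReal_iff hb0).1 key

/-- Bounded sequences in `H^1_0(ℝ⁺)` have subsequences that converge pointwise, with a weakly lower
semicontinuous Dirichlet integral. -/
theorem exists_subseq_tendsto {F G : ℕ → ℝ → ℝ} (h : ∀ n, IsH1 (F n) (G n)) {C : ℝ}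
    (hF : ∀ n, ∫ x in Ioi 0, F n x ^ 2 ≤ C) (hG : ∀ n, ∫ x in Ioi 0, G n x ^ 2 ≤ C) :
    ∃ f g : ℝ → ℝ, IsH1 f g ∧ ∃ ms : ℕ → ℕ, StrictMono ms ∧
      (∀ x, 0 ≤ x → Tendsto (fun n => F (ms n) x) atTop (𝓝 (f x))) ∧
      ∃ γ, Tendsto (fun n => ∫ x in Ioi 0, G (ms n) x ^ 2) atTop (𝓝 γ) ∧
        ∫ x in Ioi 0, g x ^ 2 ≤ γ := by
  obtain ⟨g, hg, m₁, hm₁, hw⟩ :=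
    exists_subseq_tendsto_integral_mul (fun n => (h n).memLp_deriv) hG
  obtain ⟨γ, _, m₂, hm₂, hγ⟩ := tendsto_subseq_of_bounded (Metric.isBounded_Icc (0 : ℝ) C)
    (x := fun n => ∫ x in Ioi 0, G (m₁ n) x ^ 2)
    fun n => ⟨integral_nonneg fun x => sq_nonneg _, hG _⟩
  have hw' : ∀ k : ℝ → ℝ, MemLp k 2 halfVolume → Tendsto
      (fun n => ∫ x in Ioi 0, G (m₁ (m₂ n)) x * k x) atTop (𝓝 (∫ x in Ioi 0, g x * k x)) :=
    fun k hk => (hw k hk).comp hm₂.tendsto_atTop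
  -- Pairing the derivatives with the indicator of `(0, x]` turns weak convergence into pointwise
  -- convergence of the primitives.
  have hpt : ∀ x, 0 ≤ x → Tendsto (fun n => F (m₁ (m₂ n)) x) atTop
      (𝓝 (∫ t in (0 : ℝ)..x, g t)) := by
    intro x hx
    have := hw' _ (memLp_indicator_Ioc 0 x 1)
    simp only [setIntegral_mul_indicator_Ioc le_rfl hx, mul_one] at this
    exact this.congr fun n => ((h _).eq_integral x hx).symm
  have hcont := continuousOn_of_primitive hg (f := fun x => ∫ t in (0 : ℝ)..x, g t)
    fun _ _ => rfl
  have hfi := (integrable_and_integral_le_of_tendsto (u := fun n x => F (m₁ (m₂ n)) x ^ 2)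
    (v := fun x => (∫ t in (0 : ℝ)..x, g t) ^ 2) (fun n => (h _).integrable_sq)
    (fun n => Eventually.of_forall fun x => sq_nonneg _)
    (ae_halfVolume_of_ae fun x hx => (hpt x hx.le).pow 2) (fun n => hF _)
    tendsto_const_nhds).1
  have hfm : AEStronglyMeasurable (fun x => ∫ t in (0 : ℝ)..x, g t) halfVolume :=
    (hcont.mono Ioi_subset_Ici_self).aestronglyMeasurable measurableSet_Ioi
  refine ⟨fun x => ∫ t in (0 : ℝ)..x, g t, g,
    ⟨(memLp_two_iff_integrable_sq hfm).2 hfi, hg, fun _ _ => rfl⟩, m₁ ∘ m₂, hm₁.comp hm₂, hpt, γ,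
    hγ, ?_⟩
  -- Weak lower semicontinuity from `2Gg - g² ≤ G²`, whose left side is affine in `G`.
  have hle : ∀ n, 2 * (∫ x in Ioi 0, G (m₁ (m₂ n)) x * g x) - ∫ x in Ioi 0, g x ^ 2
      ≤ ∫ x in Ioi 0, G (m₁ (m₂ n)) x ^ 2 := by
    intro n
    have i1 := (integrable_mul_of_memLp (h (m₁ (m₂ n))).memLp_deriv hg).const_mul 2
    rw [← integral_const_mul, ← integral_sub i1 hg.integrable_sq]
    refine integral_mono (i1.sub hg.integrable_sq) (h _).integrable_deriv_sq fun x => ?_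
    simp only
    nlinarith [sq_nonneg (G (m₁ (m₂ n)) x - g x)]
  have hl := ((hw' g hg).const_mul 2).sub_const (∫ x in Ioi 0, g x ^ 2)
  have := le_of_tendsto_of_tendsto' hl hγ hle
  simp_rw [← sq] at this
  linarith

/-- Integrals against an integrable weight converge for bounded sequences in `H^1_0(ℝ⁺)` that
converge pointwise. -/
theorem tendsto_integral_mul_sq {F G : ℕ → ℝ → ℝ} {f W : ℝ → ℝ} (h : ∀ n, IsH1 (F n) (G n)) {C : ℝ}
    (hF : ∀ n, ∫ x in Ioi 0, F n x ^ 2 ≤ C) (hG : ∀ n, ∫ x in Ioi 0, G n x ^ 2 ≤ C)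
    (hf : ∀ x, 0 ≤ x → Tendsto (fun n => F n x) atTop (𝓝 (f x))) (hW : Integrable W halfVolume) :
    Tendsto (fun n => ∫ x in Ioi 0, W x * F n x ^ 2) atTop (𝓝 (∫ x in Ioi 0, W x * f x ^ 2)) := by
  refine tendsto_integral_of_dominated_convergence (fun x => ‖W x‖ * (2 * (C + C)))
    (fun n => hW.aestronglyMeasurable.mul (h n).integrable_sq.aestronglyMeasurable)
    (hW.norm.mul_const _) (fun n => ae_halfVolume_of_ae fun x hx => ?_)
    (ae_halfVolume_of_ae fun x hx => ((hf x hx.le).pow 2).const_mul _)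
  rw [norm_mul, Real.norm_of_nonneg (sq_nonneg _)]
  refine mul_le_mul_of_nonneg_left (((h n).sq_le hx.le).trans ?_) (norm_nonneg _)
  linarith [hF n, hG n]

theorem IsBoundedCompact.integrable {W : ℝ → ℝ} (hW : IsBoundedCompact W) :
    Integrable W halfVolume := by
  obtain ⟨C, hC⟩ := hW.bounded
  obtain ⟨R, hR⟩ := hW.compact_support
  have hI : Integrable ((Icc 0 R).indicator fun _ => C) halfVolume := by
    rw [integrable_indicator_iff measurableSet_Icc]
    refine integrableOn_const ?_
    refine ((Measure.restrict_apply_le _ _).trans_lt ?_).ne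
    simp
  refine hI.mono' hW.aestronglyMeasurable ?_
  have hpos : ∀ᵐ x ∂halfVolume, 0 < x := ae_halfVolume_of_ae fun x hx => hx
  filter_upwards [hC, hR, hpos] with x h1 h2 h3
  by_cases hx : x ≤ R
  · rw [indicator_of_mem (show x ∈ Icc 0 R from ⟨h3.le, hx⟩)]
    exact h1
  · rw [h2 (not_le.1 hx), norm_zero]
    exact indicator_nonneg (fun x _ => (abs_nonneg _).trans h1) _

/-! ### Ground states: positivity, nonexistence and uniqueness -/

/-- `f`, with derivative `g`, minimizes the energy among multiples of normalized functions. The zero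
function is not excluded. -/
structure IsGroundState (U f g : ℝ → ℝ) : Prop extends IsH1 f g where
  integrable : Integrable (fun x => U x * f x ^ 2) halfVolume
  energy_le : (∫ x in Ioi 0, g x ^ 2) + ∫ x in Ioi 0, U x * f x ^ 2
    ≤ (fundamentalMode U).toReal * ∫ x in Ioi 0, f x ^ 2

/-- A quadratic that vanishes at 0 and is nonnegative has no linear term. The trial value `s =
-L/(|q| + 1)` works for either sign of `q`. -/
theorem eq_zero_of_forall_nonneg {L q : ℝ} (h : ∀ s : ℝ, 0 ≤ 2 * s * L + s ^ 2 * q) : L = 0 := by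
  have hq : 0 < |q| + 1 := by positivity
  have h1 := h (-(L / (|q| + 1)))
  have h2 : L = L / (|q| + 1) * (|q| + 1) := (div_mul_cancel₀ _ hq.ne').symm
  set s := L / (|q| + 1)
  have h3 : s ^ 2 * q ≤ s ^ 2 * |q| := mul_le_mul_of_nonneg_left (le_abs_self q) (sq_nonneg s)
  have h4 : 0 ≤ s ^ 2 * |q| := by positivity
  have h5 : s ^ 2 ≤ 0 := by
    rw [h2] at h1
    nlinarith
  have h6 : s = 0 := pow_eq_zero_iff two_ne_zero |>.1 (le_antisymm h5 (sq_nonneg s))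
  rw [h2, h6, zero_mul]

namespace IsGroundState

variable {U f g f₁ g₁ f₂ g₂ : ℝ → ℝ}

/-- The Euler-Lagrange equation, tested against a piecewise linear function. -/
theorem euler_lagrange (hU : IsAdmissible U) (h : IsGroundState U f g) {a p b : ℝ} (ha : 0 < a)
    (hap : a < p) (hpb : p < b) :
    (f p - f a) / (p - a) - (f b - f p) / (b - p)
      = ∫ x in Ioi 0, ((fundamentalMode U).toReal - U x) * (f x * tent a p b x) := by
  set E := (fundamentalMode U).toReal
  have hT := isH1_tent ha.le hap hpb
  have j1 := integrable_mul_of_memLp h.memLp_deriv hT.memLp_deriv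
  have j2 := integrable_mul_tent hU.locallyIntegrableOn h.continuousOn ha hap hpb
  have j3 := integrable_mul_of_memLp h.memLp hT.memLp
  have j4 := integrable_mul_tent_sq hU.locallyIntegrableOn ha hap hpb
  have exp : ∀ (u v w : ℝ → ℝ) (s : ℝ), Integrable u halfVolume → Integrable v halfVolume →
      Integrable w halfVolume →
      ∫ x in Ioi 0, (u x + 2 * s * v x + s ^ 2 * w x)
        = (∫ x in Ioi 0, u x) + 2 * s * (∫ x in Ioi 0, v x) + s ^ 2 * ∫ x in Ioi 0, w x := by
    intro u v w s hu hv hw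
    have i1 : Integrable (fun x => 2 * s * v x) halfVolume := hv.const_mul _
    have i2 : Integrable (fun x => s ^ 2 * w x) halfVolume := hw.const_mul _
    have i3 : Integrable (fun x => u x + 2 * s * v x) halfVolume := hu.add i1
    rw [integral_add i3 i2, integral_add hu i1, integral_const_mul, integral_const_mul]
  have key : (∫ x in Ioi 0, g x * tentDeriv a p b x)
      + (∫ x in Ioi 0, U x * (f x * tent a p b x)) - E * ∫ x in Ioi 0, f x * tent a p b x = 0 := by
    refine eq_zero_of_forall_nonneg (q := (∫ x in Ioi 0, tentDeriv a p b x ^ 2)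
      + (∫ x in Ioi 0, U x * tent a p b x ^ 2) - E * ∫ x in Ioi 0, tent a p b x ^ 2) fun s => ?_
    have e1 : ∀ x, (g x + s * tentDeriv a p b x) ^ 2
        = g x ^ 2 + 2 * s * (g x * tentDeriv a p b x) + s ^ 2 * tentDeriv a p b x ^ 2 :=
      fun x => by ring
    have e2 : ∀ x, U x * (f x + s * tent a p b x) ^ 2 = U x * f x ^ 2
        + 2 * s * (U x * (f x * tent a p b x)) + s ^ 2 * (U x * tent a p b x ^ 2) :=
      fun x => by ring
    have e3 : ∀ x, (f x + s * tent a p b x) ^ 2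
        = f x ^ 2 + 2 * s * (f x * tent a p b x) + s ^ 2 * tent a p b x ^ 2 :=
      fun x => by ring
    have hi : Integrable (fun x => U x * (f x + s * tent a p b x) ^ 2) halfVolume := by
      simp_rw [e2]
      exact (h.integrable.add (j2.const_mul _)).add (j4.const_mul _)
    have hle := hU.toReal_mul_le (h.toIsH1.add (hT.const_mul s)) hi
    simp_rw [e1, e2, e3] at hle
    rw [exp _ _ _ s h.integrable_deriv_sq j1 hT.integrable_deriv_sq,
      exp _ _ _ s h.integrable j2 j4, exp _ _ _ s h.integrable_sq j3 hT.integrable_sq] at hle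
    have := h.energy_le
    linarith
  rw [h.toIsH1.integral_mul_tentDeriv ha.le hap hpb] at key
  simp_rw [sub_mul]
  rw [integral_sub (j3.const_mul _) j2, integral_const_mul]
  linarith

theorem abs (h : IsGroundState U f g) :
    ∃ g', IsGroundState U (fun x => |f x|) g' := by
  obtain ⟨g', hg', hle⟩ := h.toIsH1.abs
  refine ⟨g', hg', by simpa only [sq_abs] using h.integrable, ?_⟩
  simp only [sq_abs]
  refine le_trans ?_ h.energy_le
  refine add_le_add (integral_mono_ae hg'.integrable_deriv_sq h.integrable_deriv_sq ?_) le_rfl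
  filter_upwards [hle] with x hx using sq_le_sq.2 hx

/-- The form "energy minus `E` times mass" is nonnegative and obeys the parallelogram law. It is at
most 0 at both functions and at least 0 at their sum, so it is at most 0 at their difference. -/
theorem sub (hU : IsAdmissible U) (h₁ : IsGroundState U f₁ g₁) (h₂ : IsGroundState U f₂ g₂) :
    IsGroundState U (fun x => f₁ x + -1 * f₂ x) (fun x => g₁ x + -1 * g₂ x) := by
  have hs := h₁.toIsH1.add (h₂.toIsH1.const_mul (-1))
  have ha := h₁.toIsH1.add h₂.toIsH1
  have hUi : ∀ u v : ℝ → ℝ, IsH1 u v → (∀ x, u x ^ 2 ≤ 2 * (f₁ x ^ 2 + f₂ x ^ 2)) →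
      Integrable (fun x => U x * u x ^ 2) halfVolume := by
    intro u v huv hle
    refine ((h₁.integrable.norm.add h₂.integrable.norm).const_mul 2).mono'
      (hU.aestronglyMeasurable.mul huv.integrable_sq.aestronglyMeasurable)
      (Eventually.of_forall fun x => ?_)
    simp only [Pi.add_apply, norm_mul, Real.norm_of_nonneg (sq_nonneg _)]
    nlinarith [mul_le_mul_of_nonneg_left (hle x) (norm_nonneg (U x))]
  have his := hUi _ _ hs fun x => by nlinarith [sq_nonneg (f₁ x + f₂ x)]
  have hia := hUi _ _ ha fun x => by nlinarith [sq_nonneg (f₁ x - f₂ x)]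
  refine ⟨hs, his, ?_⟩
  have par : ∀ u v w z : ℝ → ℝ, Integrable u halfVolume → Integrable v halfVolume →
      Integrable w halfVolume → Integrable z halfVolume →
      (∀ x, u x + v x = 2 * (w x + z x)) →
      (∫ x in Ioi 0, u x) + ∫ x in Ioi 0, v x
        = 2 * ((∫ x in Ioi 0, w x) + ∫ x in Ioi 0, z x) := by
    intro u v w z hu hv hw hz e
    rw [← integral_add hu hv, ← integral_add hw hz, ← integral_const_mul]
    exact integral_congr_ae (Eventually.of_forall e)
  have p1 := par _ _ _ _ hs.integrable_deriv_sq ha.integrable_deriv_sq h₁.integrable_deriv_sq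
    h₂.integrable_deriv_sq fun x => by ring
  have p2 := par _ _ _ _ his hia h₁.integrable h₂.integrable fun x => by ring
  have p3 := par _ _ _ _ hs.integrable_sq ha.integrable_sq h₁.integrable_sq
    h₂.integrable_sq fun x => by ring
  have k := hU.toReal_mul_le ha hia
  have k1 := h₁.energy_le
  have k2 := h₂.energy_le
  have p4 := congrArg (fun t => (fundamentalMode U).toReal * t) p3
  simp only [mul_add, mul_left_comm _ (2 : ℝ)] at p4
  linarith

/-- A substitute for ODE uniqueness with merely integrable coefficients. A tent centred at the zero
`x₀` bounds `f(x₀ - k) + f(x₀ + k)` by `k C` times the local maximum of `f`, and on a short interval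
this forces the maximum to be 0. -/
theorem eventually_eq_zero (hU : IsAdmissible U) (h : IsGroundState U f g)
    (hf : ∀ x, 0 < x → 0 ≤ f x) {x₀ : ℝ} (hx₀ : 0 < x₀) (h0 : f x₀ = 0) :
    ∀ᶠ x in 𝓝 x₀, f x = 0 := by
  set E := (fundamentalMode U).toReal with hE
  set r := x₀ / 2 with hr
  have hr0 : 0 < r := by positivity
  have hK : IntegrableOn (fun x => |E - U x|) (Icc (x₀ - r) (x₀ + r)) := by
    have : IntegrableOn U (Icc (x₀ - r) (x₀ + r)) :=
      hU.locallyIntegrableOn.integrableOn_compact_subset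
        (fun x hx => lt_of_lt_of_le (by rw [hr]; linarith : 0 < x₀ - r) hx.1) isCompact_Icc
    have hc : IntegrableOn (fun _ : ℝ => E) (Icc (x₀ - r) (x₀ + r)) :=
      continuousOn_const.integrableOn_compact isCompact_Icc
    exact (hc.sub this).abs
  set C := ∫ x in Icc (x₀ - r) (x₀ + r), |E - U x|
  have hC : 0 ≤ C := integral_nonneg fun x => abs_nonneg _
  set d := min r (1 / (2 * (C + 1)))
  have hd : 0 < d := by positivity
  have hdr : d ≤ r := min_le_left _ _
  have hdC : d * C < 1 := by
    have : d ≤ 1 / (2 * (C + 1)) := min_le_right _ _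
    rw [le_div_iff₀ (by positivity)] at this
    nlinarith
  have hpos : ∀ x ∈ Icc (x₀ - d) (x₀ + d), 0 < x := fun x hx => by
    have : x₀ - r = r := by rw [hr]; ring
    linarith [hx.1]
  obtain ⟨y, hy, hmax⟩ := isCompact_Icc.exists_isMaxOn (s := Icc (x₀ - d) (x₀ + d)) (f := f)
    ⟨x₀, by constructor <;> linarith⟩ (h.continuousOn.mono fun x hx => (hpos x hx).le)
  suffices hy0 : f y ≤ 0 by
    filter_upwards [Icc_mem_nhds (by linarith : x₀ - d < x₀) (by linarith : x₀ < x₀ + d)] with x hx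
    exact le_antisymm ((hmax hx).trans hy0) (hf x (hpos x hx))
  by_contra! hy0
  -- With this `k` the maximum point `y` is one of the feet `x₀ ± k` of the tent.
  set k := |y - x₀| with hk
  have hk0 : 0 < k := abs_pos.2 (sub_ne_zero.2 fun e => by rw [e, h0] at hy0; exact lt_irrefl _ hy0)
  have hkd : k ≤ d := abs_le.2 ⟨by linarith [hy.1], by linarith [hy.2]⟩
  have hka : 0 < x₀ - k := hpos _ ⟨by linarith, by linarith⟩
  have hEL := h.euler_lagrange hU hka (by linarith : x₀ - k < x₀) (by linarith : x₀ < x₀ + k)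
  rw [h0, ← hE, sub_sub_cancel, add_sub_cancel_left] at hEL
  have hint : -∫ x in Ioi 0, (E - U x) * (f x * tent (x₀ - k) x₀ (x₀ + k) x) ≤ C * f y := by
    have hs : Icc (x₀ - r) (x₀ + r) ⊆ Ioi 0 := fun x hx =>
      lt_of_lt_of_le (by rw [hr]; linarith : 0 < x₀ - r) hx.1
    have e : C * f y = ∫ x in Ioi 0,
        (Icc (x₀ - r) (x₀ + r)).indicator (fun x => |E - U x| * f y) x := by
      rw [setIntegral_indicator measurableSet_Icc, inter_eq_self_of_subset_right hs,
        integral_mul_const]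
    rw [e, ← integral_neg]
    have hi1 : Integrable (fun x => (E - U x) * (f x * tent (x₀ - k) x₀ (x₀ + k) x)) halfVolume :=
      integrable_mul_tent ((locallyIntegrable_const E).locallyIntegrableOn _ |>.sub
        hU.locallyIntegrableOn) h.continuousOn hka (by linarith) (by linarith)
    have hi2 : Integrable ((Icc (x₀ - r) (x₀ + r)).indicator (fun x => |E - U x| * f y))
        halfVolume := by
      rw [integrable_indicator_iff measurableSet_Icc]
      exact (hK.mul_const _).mono_measure (Measure.restrict_mono' (ae_of_all _ fun x hx => hx)
        Measure.restrict_le_self)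
    refine integral_mono_ae hi1.neg hi2 (ae_halfVolume_of_ae fun x hx => ?_)
    by_cases hxk : x ∈ Icc (x₀ - k) (x₀ + k)
    · have hxd : x ∈ Icc (x₀ - d) (x₀ + d) := ⟨by linarith [hxk.1], by linarith [hxk.2]⟩
      have hxr : x ∈ Icc (x₀ - r) (x₀ + r) := ⟨by linarith [hxk.1], by linarith [hxk.2]⟩
      simp only [indicator_of_mem hxr]
      have hT0 := tent_nonneg (x₀ - k) x₀ (x₀ + k) x
      have hT1 := tent_le_one (by linarith : x₀ - k < x₀) (by linarith : x₀ < x₀ + k) x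
      have hfx := hf x hx
      have hm : f x ≤ f y := hmax hxd
      have h1 : f x * tent (x₀ - k) x₀ (x₀ + k) x ≤ f y := by nlinarith
      simp only [← neg_mul]
      exact (mul_le_mul_of_nonneg_right (neg_le_abs _) (mul_nonneg hfx hT0)).trans
        (mul_le_mul_of_nonneg_left h1 (abs_nonneg _))
    · simp only [tent_eq_zero (by linarith : x₀ - k < x₀) (by linarith : x₀ < x₀ + k) hxk, mul_zero,
        neg_zero]
      exact indicator_nonneg (fun x _ => mul_nonneg (abs_nonneg _) hy0.le) _
  have hfa := hf _ hka
  have hfb := hf (x₀ + k) (by linarith)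
  have hsum : f y ≤ f (x₀ - k) + f (x₀ + k) := by
    rcases le_total 0 (y - x₀) with hle | hle
    · have : x₀ + k = y := by rw [hk, abs_of_nonneg hle]; ring
      rw [this] at hfb ⊢; linarith
    · have : x₀ - k = y := by rw [hk, abs_of_nonpos hle]; ring
      rw [this] at hfa ⊢; linarith
  have h3 : f (x₀ - k) + f (x₀ + k) ≤ k * (C * f y) := by
    have e : (0 - f (x₀ - k)) / k - (f (x₀ + k) - 0) / k = -(f (x₀ - k) + f (x₀ + k)) / k := by ring
    rw [← hEL, e, neg_div, neg_neg, div_le_iff₀ hk0] at hint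
    linarith
  nlinarith [mul_le_mul_of_nonneg_right hkd (mul_nonneg hC hy0.le)]

/-- The zero set is open by `eventually_eq_zero` and its complement is open by continuity; the
half-line is connected. -/
theorem eq_zero_or_pos (hU : IsAdmissible U) (h : IsGroundState U f g)
    (hf : ∀ x, 0 < x → 0 ≤ f x) : (∀ x, 0 < x → f x = 0) ∨ ∀ x, 0 < x → 0 < f x := by
  by_contra! hn
  obtain ⟨⟨y, hy, hy0⟩, x, hx, hx0⟩ := hn
  have hc : ContinuousOn f (Ioi 0) := h.continuousOn.mono Ioi_subset_Ici_self
  obtain ⟨z, hz, hzu, hzv⟩ := isPreconnected_Ioi {x | ∀ᶠ y in 𝓝 x, f y = 0}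
    (Ioi (0 : ℝ) ∩ f ⁻¹' {0}ᶜ) isOpen_setOfPred_eventually_nhds
    (hc.isOpen_inter_preimage isOpen_Ioi isOpen_compl_singleton)
    (fun z hz => by
      by_cases h0 : f z = 0
      · exact Or.inl (h.eventually_eq_zero hU hf hz h0)
      · exact Or.inr ⟨hz, h0⟩)
    ⟨x, hx, h.eventually_eq_zero hU hf hx (le_antisymm hx0 (hf x hx))⟩
    ⟨y, hy, hy, hy0⟩
  exact hzv.2 hzu.self_of_nhds

/-- If the potential is at most the fundamental mode, there is no ground state: its absolute value
would be concave. -/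
theorem eq_zero_of_le (hU : IsPotential U)
    (hle : ∀ᵐ x ∂halfVolume, U x ≤ (fundamentalMode U).toReal) (h : IsGroundState U f g)
    {x : ℝ} (hx : 0 < x) : f x = 0 := by
  obtain ⟨g', h'⟩ := h.abs
  set u : ℝ → ℝ := fun x => |f x|
  have hu0 : ∀ x, 0 ≤ u x := fun x => abs_nonneg _
  have hconc : ∀ a p b, 0 < a → a < p → p < b →
      (u b - u p) / (b - p) ≤ (u p - u a) / (p - a) := by
    intro a p b ha hap hpb
    have hEL := h'.euler_lagrange hU.isAdmissible ha hap hpb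
    have : 0 ≤ ∫ x in Ioi 0, ((fundamentalMode U).toReal - U x) * (u x * tent a p b x) := by
      refine integral_nonneg_of_ae ?_
      filter_upwards [hle] with x hx
      exact mul_nonneg (sub_nonneg.2 hx) (mul_nonneg (hu0 x) (tent_nonneg a p b x))
    linarith
  have hmono : ∀ a p, 0 < a → a < p → u a ≤ u p := by
    intro a p ha hap
    by_contra! hlt
    set d := (u p - u a) / (p - a)
    have hd : d < 0 := div_neg_of_neg_of_pos (by linarith) (by linarith)
    have hup : 0 ≤ u p := hu0 p
    -- A concave function with a chord of slope `d < 0` lies below the extended chord, which at this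
    -- point has the negative value `d`.
    have hb := hconc a p (p + (u p / (-d) + 1)) ha hap (by
      have : 0 ≤ u p / (-d) := div_nonneg hup (by linarith)
      linarith)
    have hpos : 0 < u p / (-d) + 1 := by
      have : 0 ≤ u p / (-d) := div_nonneg hup (by linarith)
      linarith
    rw [add_sub_cancel_left, div_le_iff₀ hpos] at hb
    have e : d * (u p / (-d) + 1) = -u p + d := by
      have : d ≠ 0 := hd.ne
      field_simp
    have := hu0 (p + (u p / (-d) + 1))
    linarith
  by_contra hne
  have hpos : 0 < u x := abs_pos.2 hne
  have hi := h'.integrable_sq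
  obtain ⟨n, hn⟩ := exists_nat_gt ((∫ t in Ioi 0, u t ^ 2) / u x ^ 2)
  rw [div_lt_iff₀ (by positivity)] at hn
  have hs : Ioc x (x + n) ⊆ Ioi 0 := fun y hy => hx.trans hy.1
  have h1 : ∫ t in Ioc x (x + n), u x ^ 2 ≤ ∫ t in Ioc x (x + n), u t ^ 2 := by
    refine setIntegral_mono_on (by simp)
      (hi.mono_measure (Measure.restrict_mono hs le_rfl)) measurableSet_Ioc fun y hy => ?_
    exact pow_le_pow_left₀ (hu0 x) (hmono x y hx hy.1) 2
  have h2 := setIntegral_mono_set hi (Eventually.of_forall fun t => sq_nonneg _) hs.eventuallyLE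
  rw [setIntegral_const, Measure.real, Real.volume_Ioc,
    ENNReal.toReal_ofReal (by linarith [Nat.cast_nonneg (α := ℝ) n]), smul_eq_mul,
    add_sub_cancel_left] at h1
  linarith

/-- Uniqueness of the normalized nonnegative ground state. -/
theorem eqOn_of_nonneg (hU : IsAdmissible U) (h₁ : IsGroundState U f₁ g₁)
    (h₂ : IsGroundState U f₂ g₂) (hn₁ : ∫ x in Ioi 0, f₁ x ^ 2 = 1)
    (hn₂ : ∫ x in Ioi 0, f₂ x ^ 2 = 1) (hp₁ : ∀ x, 0 < x → 0 ≤ f₁ x)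
    (hp₂ : ∀ x, 0 < x → 0 ≤ f₂ x) : EqOn f₁ f₂ (Ici 0) := by
  obtain ⟨g', h'⟩ := (h₁.sub hU h₂).abs
  rcases h'.eq_zero_or_pos hU fun x _ => abs_nonneg _ with h0 | hpos
  · intro x hx
    rcases (mem_Ici.1 hx).eq_or_lt with rfl | hx
    · rw [h₁.map_zero, h₂.map_zero]
    · have := abs_eq_zero.1 (h0 x hx)
      linarith
  exfalso
  -- A nowhere vanishing difference has constant sign, which is incompatible with equal norms of two
  -- nonnegative functions.
  have hne : ∀ x, 0 < x → f₁ x - f₂ x ≠ 0 := fun x hx e => by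
    have := hpos x hx
    rw [show f₁ x + -1 * f₂ x = f₁ x - f₂ x by ring, e, abs_zero] at this
    exact lt_irrefl _ this
  have hc : ContinuousOn (fun x => f₁ x - f₂ x) (Ioi 0) :=
    (h₁.continuousOn.sub h₂.continuousOn).mono Ioi_subset_Ici_self
  have strict : ∀ u v : ℝ → ℝ, Integrable (fun x => u x ^ 2) halfVolume →
      Integrable (fun x => v x ^ 2) halfVolume → (∀ x, 0 < x → 0 ≤ u x) →
      (∀ x, 0 < x → u x < v x) → ∫ x in Ioi 0, u x ^ 2 < ∫ x in Ioi 0, v x ^ 2 := by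
    intro u v hu hv h0 huv
    rw [← sub_pos, ← integral_sub hv hu]
    have hp : ∀ x ∈ Ioi (0 : ℝ), 0 < v x ^ 2 - u x ^ 2 := fun x hx =>
      sub_pos.2 (pow_lt_pow_left₀ (huv x hx) (h0 x hx) two_ne_zero)
    rw [setIntegral_pos_iff_support_of_nonneg_ae
      (ae_halfVolume_of_ae fun x hx => (hp x hx).le) (hv.sub hu)]
    have : Function.support (fun x => v x ^ 2 - u x ^ 2) ∩ Ioi 0 = Ioi 0 :=
      inter_eq_self_of_subset_right fun x hx => (hp x hx).ne'
    rw [this]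
    simp
  by_cases hs : ∀ x, 0 < x → f₂ x < f₁ x
  · have := strict f₂ f₁ h₂.integrable_sq h₁.integrable_sq hp₂ hs
    linarith
  push Not at hs
  obtain ⟨y, hy, hys⟩ := hs
  have := strict f₁ f₂ h₁.integrable_sq h₂.integrable_sq hp₁ fun x hx => by
    by_contra! hx'
    obtain ⟨z, hz, hz0⟩ := isPreconnected_Ioi.intermediate_value hy hx hc
      (show (0 : ℝ) ∈ Icc (f₁ y - f₂ y) (f₁ x - f₂ x) from ⟨by linarith, by linarith⟩)
    exact hne z hz hz0
  linarith

end IsGroundState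

/-! ### Minimizing sequences -/

/-- Normalized sequences whose energy converges to the fundamental mode. -/
structure IsMinimizingSeq (U : ℝ → ℝ) (F G : ℕ → ℝ → ℝ) : Prop where
  isH1 : ∀ n, IsH1 (F n) (G n)
  integral_sq : ∀ n, ∫ x in Ioi 0, F n x ^ 2 = 1
  integrable : ∀ n, Integrable (fun x => U x * F n x ^ 2) halfVolume
  tendsto : Tendsto (fun n => (∫ x in Ioi 0, G n x ^ 2) + ∫ x in Ioi 0, U x * F n x ^ 2) atTop
    (𝓝 (fundamentalMode U).toReal)

theorem IsAdmissible.exists_isMinimizingSeq {U : ℝ → ℝ} (hU : IsAdmissible U) :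
    ∃ F G, IsMinimizingSeq U F G := by
  choose F G h1 h2 h3 h4 using fun n : ℕ => hU.exists_lt (Nat.one_div_pos_of_nat (α := ℝ) (n := n))
  refine ⟨F, G, h1, h2, h3, ?_⟩
  refine tendsto_of_tendsto_of_tendsto_of_le_of_le tendsto_const_nhds
    ?_ (fun n => hU.toReal_le (h1 n) (h2 n) (h3 n)) fun n => (h4 n).le
  simpa only [add_zero] using tendsto_one_div_add_atTop_nhds_zero_nat.const_add
    (fundamentalMode U).toReal

theorem integrable_mul_sq_of_bounded {W f : ℝ → ℝ} (hW : AEStronglyMeasurable W halfVolume) {C : ℝ}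
    (hC : ∀ᵐ x ∂halfVolume, |W x| ≤ C) (hf : Integrable (fun x => f x ^ 2) halfVolume) :
    Integrable (fun x => W x * f x ^ 2) halfVolume :=
  hf.bdd_mul hW (by simpa using hC)

theorem integrable_indicator_Iio {W : ℝ → ℝ} (hW : AEStronglyMeasurable W halfVolume) {C : ℝ}
    (hC : ∀ᵐ x ∂halfVolume, |W x| ≤ C) (R : ℝ) : Integrable ((Iio R).indicator W) halfVolume := by
  refine IsBoundedCompact.integrable ⟨hW.indicator measurableSet_Iio, ⟨C, ?_⟩, R,
    Eventually.of_forall fun x hx => indicator_of_notMem (s := Iio R) (not_lt.2 hx.le) _⟩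
  filter_upwards [hC] with x hx
  by_cases h : x ∈ Iio R
  · rwa [indicator_of_mem h]
  · rw [indicator_of_notMem h, abs_zero]
    exact (abs_nonneg _).trans hx

/-- Minimizing sequences have subsequences that converge pointwise. -/
theorem IsMinimizingSeq.exists_subseq {U : ℝ → ℝ} (hU : IsPotential U) {F G : ℕ → ℝ → ℝ}
    (h : IsMinimizingSeq U F G) :
    ∃ f g : ℝ → ℝ, IsH1 f g ∧ ∃ ms : ℕ → ℕ, StrictMono ms ∧
      (∀ x, 0 ≤ x → Tendsto (fun n => F (ms n) x) atTop (𝓝 (f x))) ∧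
      (∀ W, Integrable W halfVolume → Tendsto (fun n => ∫ x in Ioi 0, W x * F (ms n) x ^ 2) atTop
        (𝓝 (∫ x in Ioi 0, W x * f x ^ 2))) ∧
      ∃ γ, Tendsto (fun n => ∫ x in Ioi 0, U x * F (ms n) x ^ 2) atTop
        (𝓝 ((fundamentalMode U).toReal - γ)) ∧ ∫ x in Ioi 0, g x ^ 2 ≤ γ := by
  obtain ⟨B, hB⟩ := h.tendsto.bddAbove_range
  have hG : ∀ n, ∫ x in Ioi 0, G n x ^ 2 ≤ max B 1 := fun n => by
    have h0 : 0 ≤ ∫ x in Ioi 0, U x * F n x ^ 2 := integral_nonneg_of_ae (by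
      filter_upwards [hU.nonneg] with x hx using mul_nonneg hx (sq_nonneg _))
    have h1 := hB (mem_range_self n)
    exact le_max_of_le_left (le_trans (le_add_of_nonneg_right h0) h1)
  have hF : ∀ n, ∫ x in Ioi 0, F n x ^ 2 ≤ max B 1 := fun n =>
    (h.integral_sq n).trans_le (le_max_right _ _)
  obtain ⟨f, g, hfg, ms, hms, hpt, γ, hγ, hle⟩ := HalfLine.exists_subseq_tendsto h.isH1 hF hG
  refine ⟨f, g, hfg, ms, hms, hpt, fun W hW => tendsto_integral_mul_sq (fun n => h.isH1 (ms n))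
    (fun n => hF _) (fun n => hG _) hpt hW, γ, ?_, hle⟩
  have := (h.tendsto.comp hms.tendsto_atTop).sub hγ
  refine this.congr fun n => ?_
  simp

/-- Below the lower limit of the potential, no mass is lost at infinity. -/
theorem IsMinimizingSeq.exists_isGroundState {U : ℝ → ℝ} (hU : IsPotential U) {F G : ℕ → ℝ → ℝ}
    (h : IsMinimizingSeq U F G) {c R : ℝ} (hc : (fundamentalMode U).toReal < c)
    (hR : ∀ᵐ x ∂halfVolume, R ≤ x → c ≤ U x) :
    ∃ f g : ℝ → ℝ, IsGroundState U f g ∧ ∫ x in Ioi 0, f x ^ 2 = 1 ∧ ∃ ms : ℕ → ℕ,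
      StrictMono ms ∧ ∀ W, Integrable W halfVolume →
        Tendsto (fun n => ∫ x in Ioi 0, W x * F (ms n) x ^ 2) atTop
        (𝓝 (∫ x in Ioi 0, W x * f x ^ 2)) := by
  obtain ⟨f, g, hfg, ms, hms, hpt, hW, γ, hγ, hgγ⟩ := h.exists_subseq hU
  set E := (fundamentalMode U).toReal
  have hptae := ae_halfVolume_of_ae fun x hx => (hpt x hx.le).pow 2
  have hm1 : ∫ x in Ioi 0, f x ^ 2 ≤ 1 :=
    (integrable_and_integral_le_of_tendsto (fun n => (h.isH1 (ms n)).integrable_sq)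
      (fun n => Eventually.of_forall fun x => sq_nonneg _) hptae
      (fun n => (h.integral_sq _).le) tendsto_const_nhds).2
  -- Adding `V` makes `U - c + V` nonnegative, so Fatou applies, while the contribution of `V`
  -- converges exactly because it is integrable.
  set V : ℝ → ℝ := (Iio R).indicator fun _ => c
  have hVm : AEStronglyMeasurable V halfVolume :=
    (aestronglyMeasurable_const).indicator measurableSet_Iio
  have hV : Integrable V halfVolume :=
    integrable_indicator_Iio aestronglyMeasurable_const (C := |c|)
      (Eventually.of_forall fun _ => le_rfl) R
  have hVb : ∀ᵐ x ∂halfVolume, |V x| ≤ |c| := Eventually.of_forall fun x => by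
    by_cases hx : x ∈ Iio R
    · simp only [V, indicator_of_mem hx, le_refl]
    · simp only [V, indicator_of_notMem hx, abs_zero, abs_nonneg]
  have hsplit : ∀ u : ℝ → ℝ, Integrable (fun x => U x * u x ^ 2) halfVolume →
      Integrable (fun x => u x ^ 2) halfVolume →
      Integrable (fun x => (U x - c + V x) * u x ^ 2) halfVolume ∧
      ∫ x in Ioi 0, (U x - c + V x) * u x ^ 2 = (∫ x in Ioi 0, U x * u x ^ 2)
        - c * (∫ x in Ioi 0, u x ^ 2) + ∫ x in Ioi 0, V x * u x ^ 2 := by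
    intro u hUu hu
    have i1 := hu.const_mul c
    have i2 := integrable_mul_sq_of_bounded hVm hVb hu
    have i3 : Integrable (fun x => U x * u x ^ 2 - c * u x ^ 2) halfVolume := hUu.sub i1
    have e : ∀ x, (U x - c + V x) * u x ^ 2 = U x * u x ^ 2 - c * u x ^ 2 + V x * u x ^ 2 :=
      fun x => by ring
    simp_rw [e]
    refine ⟨i3.add i2, ?_⟩
    rw [integral_add i3 i2, integral_sub hUu i1, integral_const_mul]
  obtain ⟨hvi, hvle⟩ := integrable_and_integral_le_of_tendsto
    (u := fun n x => (U x - c + V x) * F (ms n) x ^ 2) (v := fun x => (U x - c + V x) * f x ^ 2)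
    (fun n => (hsplit _ (h.integrable _) (h.isH1 _).integrable_sq).1)
    (fun n => by
      filter_upwards [hR, hU.nonneg] with x hx hx0
      refine mul_nonneg ?_ (sq_nonneg _)
      by_cases hxR : x < R
      · simp only [V, indicator_of_mem (mem_Iio.2 hxR)]; linarith
      · simp only [V, indicator_of_notMem (show x ∉ Iio R from hxR)]
        linarith [hx (not_lt.1 hxR)])
    (by filter_upwards [hptae] with x hx using hx.const_mul _)
    (fun n => (hsplit _ (h.integrable _) (h.isH1 _).integrable_sq).2.le)
    (((hγ.sub_const (c * 1)).add (hW V hV)).congr fun n => by rw [h.integral_sq])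
  have hVf := integrable_mul_sq_of_bounded hVm hVb hfg.integrable_sq
  have hUf : Integrable (fun x => U x * f x ^ 2) halfVolume := by
    refine ((hvi.add (hfg.integrable_sq.const_mul c)).sub hVf).congr
      (Eventually.of_forall fun x => ?_)
    simp only [Pi.add_apply, Pi.sub_apply]
    ring
  rw [(hsplit f hUf hfg.integrable_sq).2] at hvle
  have hlow := hU.isAdmissible.toReal_mul_le hfg hUf
  -- With `m` the mass of the limit, the Fatou bound and the variational inequality give `(c - E)(1
  -- - m) ≤ 0`, and `E < c`.
  have hm : ∫ x in Ioi 0, f x ^ 2 = 1 := by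
    refine le_antisymm hm1 ?_
    by_contra! hlt
    nlinarith
  refine ⟨f, g, ⟨hfg, hUf, ?_⟩, hm, ms, hms, hW⟩
  rw [hm] at hvle ⊢
  linarith

/-- If the fundamental mode is both the supremum and the limit of the potential, minimizing
sequences vanish locally. -/
theorem IsMinimizingSeq.exists_tendsto_zero {U : ℝ → ℝ} (hU : IsPotential U) {F G : ℕ → ℝ → ℝ}
    (h : IsMinimizingSeq U F G) (hle : ∀ᵐ x ∂halfVolume, U x ≤ (fundamentalMode U).toReal)
    (hlim : ∀ ε : ℝ, 0 < ε → ∃ R : ℝ, ∀ᵐ x ∂halfVolume, R ≤ x →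
      (fundamentalMode U).toReal - ε ≤ U x) :
    ∃ ms : ℕ → ℕ, StrictMono ms ∧ ∀ W, Integrable W halfVolume →
      Tendsto (fun n => ∫ x in Ioi 0, W x * F (ms n) x ^ 2) atTop (𝓝 0) := by
  obtain ⟨f, g, hfg, ms, hms, hpt, hW, γ, hγ, hgγ⟩ := h.exists_subseq hU
  set E := (fundamentalMode U).toReal with hE
  have hUb : ∀ᵐ x ∂halfVolume, |U x| ≤ E := by
    filter_upwards [hle, hU.nonneg] with x hx hx0 using (abs_of_nonneg hx0).trans_le hx
  have hEUb : ∀ᵐ x ∂halfVolume, |E - U x| ≤ E := by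
    filter_upwards [hle, hU.nonneg] with x hx hx0
    rw [abs_of_nonneg (by linarith)]; linarith
  have hEUm : AEStronglyMeasurable (fun x => E - U x) halfVolume :=
    aestronglyMeasurable_const.sub hU.isAdmissible.aestronglyMeasurable
  have hUf := integrable_mul_sq_of_bounded hU.isAdmissible.aestronglyMeasurable hUb
    hfg.integrable_sq
  have hsub : ∀ u : ℝ → ℝ, Integrable (fun x => u x ^ 2) halfVolume →
      ∫ x in Ioi 0, (E - U x) * u x ^ 2
        = E * (∫ x in Ioi 0, u x ^ 2) - ∫ x in Ioi 0, U x * u x ^ 2 := by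
    intro u hu
    simp_rw [sub_mul]
    rw [integral_sub (hu.const_mul E) (integrable_mul_sq_of_bounded
      hU.isAdmissible.aestronglyMeasurable hUb hu), integral_const_mul]
  -- `γ` is the limit of `∫ (E - U) F²`. Beyond `R` the weight is at most `ε` and the mass is at
  -- most 1; before `R` the weight is integrable and the integrals converge.
  have hγle : γ ≤ ∫ x in Ioi 0, (E - U x) * f x ^ 2 := by
    refine le_of_forall_pos_le_add fun ε hε => ?_
    obtain ⟨R, hR⟩ := hlim ε hε
    set V : ℝ → ℝ := (Iio R).indicator fun x => E - U x
    have hV := integrable_indicator_Iio hEUm hEUb R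
    have hVm : AEStronglyMeasurable V halfVolume := hEUm.indicator measurableSet_Iio
    have hVb : ∀ᵐ x ∂halfVolume, 0 ≤ V x ∧ V x ≤ E - U x ∧ E - U x ≤ V x + ε ∧ |V x| ≤ E := by
      filter_upwards [hle, hU.nonneg, hR] with x h1 h2 h3
      by_cases hx : x < R
      · simp only [V, indicator_of_mem (mem_Iio.2 hx)]
        exact ⟨by linarith, le_rfl, by linarith, by rw [abs_of_nonneg (by linarith)]; linarith⟩
      · simp only [V, indicator_of_notMem (show x ∉ Iio R from hx)]
        exact ⟨le_rfl, by linarith, by linarith [h3 (not_lt.1 hx)], by rw [abs_zero]; linarith⟩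
    have hVi : ∀ u : ℝ → ℝ, Integrable (fun x => u x ^ 2) halfVolume →
        Integrable (fun x => V x * u x ^ 2) halfVolume := fun u hu =>
      integrable_mul_sq_of_bounded hVm (hVb.mono fun x hx => hx.2.2.2) hu
    have h1 : γ ≤ (∫ x in Ioi 0, V x * f x ^ 2) + ε := by
      have hl : Tendsto (fun n => E - ∫ x in Ioi 0, U x * F (ms n) x ^ 2) atTop (𝓝 γ) := by
        simpa using hγ.const_sub E
      refine le_of_tendsto_of_tendsto' hl ((hW V hV).add_const ε) fun n => ?_
      have hF := (h.isH1 (ms n)).integrable_sq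
      have e := hsub _ hF
      rw [h.integral_sq, mul_one] at e
      rw [← e]
      have e2 : ε = ∫ x in Ioi 0, ε * F (ms n) x ^ 2 := by
        rw [integral_const_mul, h.integral_sq, mul_one]
      rw [e2, ← integral_add (hVi _ hF) (hF.const_mul ε)]
      refine integral_mono_ae (integrable_mul_sq_of_bounded hEUm hEUb hF)
        ((hVi _ hF).add (hF.const_mul ε)) ?_
      filter_upwards [hVb] with x hx
      nlinarith [mul_le_mul_of_nonneg_right hx.2.2.1 (sq_nonneg (F (ms n) x))]
    refine h1.trans (add_le_add ?_ le_rfl)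
    refine integral_mono_ae (hVi _ hfg.integrable_sq)
      (integrable_mul_sq_of_bounded hEUm hEUb hfg.integrable_sq) ?_
    filter_upwards [hVb] with x hx using mul_le_mul_of_nonneg_right hx.2.1 (sq_nonneg _)
  rw [hsub f hfg.integrable_sq] at hγle
  -- Mass may be lost here, so `f` need not be normalized; admitting the zero function as a ground
  -- state lets `eq_zero_of_le` apply.
  have hgs : IsGroundState U f g := ⟨hfg, hUf, by linarith⟩
  refine ⟨ms, hms, fun W hWi => ?_⟩
  have hz : ∫ x in Ioi 0, W x * f x ^ 2 = 0 := integral_eq_zero_of_ae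
    (ae_halfVolume_of_ae fun x hx => by simp [hgs.eq_zero_of_le hU hle hx])
  simpa only [hz] using hW W hWi

/-! ### Gâteaux derivatives -/

/-- The Gâteaux derivative of the fundamental mode is determined by the minimizing sequences. -/
theorem hasGateauxDeriv_of_isMinimizingSeq {U W : ℝ → ℝ} (hU : IsPotential U)
    (hW : IsBoundedCompact W) {d : ℝ}
    (hseq : ∀ F G, IsMinimizingSeq U F G → ∃ ms : ℕ → ℕ,
      StrictMono ms ∧ Tendsto (fun n => ∫ x in Ioi 0, W x * F (ms n) x ^ 2) atTop (𝓝 d))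
    (hup : ∀ t : ℝ, (fundamentalMode fun ξ => U ξ + t * W ξ).toReal
      ≤ (fundamentalMode U).toReal + t * d) :
    HasGateauxDeriv fundamentalMode U W d := by
  have hA := fun t => hU.isAdmissible.add_mul hW t
  refine ⟨Eventually.of_forall fun t =>
    ⟨(hA t).fundamentalMode_ne_top, (hA t).fundamentalMode_ne_bot⟩, ?_⟩
  set e : ℝ → ℝ := fun t => (fundamentalMode fun ξ => U ξ + t * W ξ).toReal with he
  set E := (fundamentalMode U).toReal with hE
  have he0 : e 0 = E := by simp [he, hE]
  obtain ⟨C, hC⟩ := hW.bounded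
  have hWi : ∀ u : ℝ → ℝ, Integrable (fun x => u x ^ 2) halfVolume →
      Integrable (fun x => W x * u x ^ 2) halfVolume :=
    fun u hu => integrable_mul_sq_of_bounded hW.aestronglyMeasurable hC hu
  rw [hasDerivAt_iff_tendsto_slope_zero]
  simp only [zero_add, he0, smul_eq_mul]
  refine tendsto_of_subseq_tendsto fun ns hns => ?_
  rw [tendsto_nhdsWithin_iff] at hns
  obtain ⟨N, hN⟩ := eventually_atTop.1 hns.2
  -- Discarding the first `N` terms makes every increment nonzero.
  set t : ℕ → ℝ := fun n => ns (n + N) with ht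
  have ht0 : ∀ n, t n ≠ 0 := fun n => hN _ (Nat.le_add_left _ _)
  have htl : Tendsto t atTop (𝓝 0) := hns.1.comp (tendsto_add_atTop_nat N)
  have ht2 : ∀ n, 0 < t n ^ 2 := fun n => by have := ht0 n; positivity
  -- The tolerance `t²` is negligible after division by `t`.
  choose F G h1 h2 h3 h4 using fun n => (hA (t n)).exists_lt (ht2 n)
  have hUi : ∀ n, Integrable (fun x => U x * F n x ^ 2) halfVolume := fun n => by
    refine ((h3 n).sub ((hWi _ (h1 n).integrable_sq).const_mul (t n))).congr
      (Eventually.of_forall fun x => ?_)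
    simp only [Pi.sub_apply]
    ring
  have hsum : ∀ n, ∫ x in Ioi 0, (U x + t n * W x) * F n x ^ 2
      = (∫ x in Ioi 0, U x * F n x ^ 2) + t n * ∫ x in Ioi 0, W x * F n x ^ 2 := by
    intro n
    have i1 := (hWi _ (h1 n).integrable_sq).const_mul (t n)
    rw [← integral_const_mul, ← integral_add (hUi n) i1]
    exact integral_congr_ae (Eventually.of_forall fun x => by simp only; ring)
  have hlow : ∀ n, E ≤ (∫ x in Ioi 0, G n x ^ 2) + ∫ x in Ioi 0, U x * F n x ^ 2 := fun n =>
    hU.isAdmissible.toReal_le (h1 n) (h2 n) (hUi n)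
  have hwb : ∀ n, |∫ x in Ioi 0, W x * F n x ^ 2| ≤ C := by
    intro n
    refine (norm_integral_le_integral_norm (fun x => W x * F n x ^ 2)).trans ?_
    rw [show C = ∫ x in Ioi 0, C * F n x ^ 2 by rw [integral_const_mul, h2, mul_one]]
    refine integral_mono_ae (hWi _ (h1 n).integrable_sq).norm ((h1 n).integrable_sq.const_mul C) ?_
    filter_upwards [hC] with x hx
    rw [norm_mul, Real.norm_of_nonneg (sq_nonneg _)]
    exact mul_le_mul_of_nonneg_right hx (sq_nonneg _)
  have hub : ∀ n, (∫ x in Ioi 0, G n x ^ 2) + ∫ x in Ioi 0, U x * F n x ^ 2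
      ≤ E + t n * d + t n ^ 2 + |t n| * C := by
    intro n
    have k1 := h4 n
    have k2 := hup (t n)
    rw [hsum] at k1
    have k3 : |t n * ∫ x in Ioi 0, W x * F n x ^ 2| ≤ |t n| * C := by
      rw [abs_mul]; exact mul_le_mul_of_nonneg_left (hwb n) (abs_nonneg _)
    have k4 := neg_le_of_abs_le k3
    linarith
  have hmin : IsMinimizingSeq U F G := by
    refine ⟨h1, h2, hUi, tendsto_of_tendsto_of_tendsto_of_le_of_le tendsto_const_nhds ?_ hlow hub⟩
    have := (((htl.mul_const d).const_add E).add (htl.pow 2)).add (htl.abs.mul_const C)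
    simpa using this
  obtain ⟨ms, hmono, hms⟩ := hseq F G hmin
  refine ⟨fun n => ms n + N, ?_⟩
  change Tendsto (fun n => (t (ms n))⁻¹ * (e (t (ms n)) - E)) atTop (𝓝 d)
  rw [tendsto_iff_norm_sub_tendsto_zero] at hms ⊢
  have htm : Tendsto (fun n => |t (ms n)|) atTop (𝓝 0) := by
    simpa using (htl.comp hmono.tendsto_atTop).abs
  refine squeeze_zero (fun n => norm_nonneg _) (fun n => ?_)
    (by simpa only [add_zero] using hms.add htm)
  set s := t (ms n)
  set w := ∫ x in Ioi 0, W x * F (ms n) x ^ 2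
  have hs0 : s ≠ 0 := ht0 _
  -- The increment lies between `s w - s²` and `s d`, so the difference quotient is within `|w - d|
  -- + |s|` of `d` for either sign of `s`.
  have k1 : e s - E ≤ s * d := by linarith [hup s]
  have k2 : s * w - s ^ 2 ≤ e s - E := by
    have k3 := h4 (ms n)
    rw [hsum] at k3
    have k4 := hlow (ms n)
    simp only [he]
    linarith
  have e1 : s⁻¹ * (e s - E) - d = s⁻¹ * (e s - E - s * d) := by field_simp
  rw [e1, norm_mul, norm_inv, Real.norm_eq_abs, Real.norm_eq_abs, Real.norm_eq_abs,
    inv_mul_le_iff₀ (abs_pos.2 hs0), abs_of_nonpos (by linarith)]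
  have k5 : -(|s| * |w - d|) ≤ s * (w - d) := by
    rw [← abs_mul]; exact neg_abs_le _
  have k6 : |s| * |s| = s ^ 2 := by rw [abs_mul_abs_self, sq]
  linarith

/-! ### The bound state and threshold cases -/

theorem IsGroundState.energy_eq {U f g : ℝ → ℝ} (hU : IsAdmissible U) (h : IsGroundState U f g)
    (h1 : ∫ x in Ioi 0, f x ^ 2 = 1) : energy U f = fundamentalMode U := by
  have k1 := hU.toReal_le h.toIsH1 h1 h.integrable
  have k2 := h.energy_le
  rw [h1, mul_one] at k2
  rw [HalfLine.energy_eq h.toIsH1 h.integrable, le_antisymm k2 k1, hU.coe_toReal]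

theorem isGroundState_of_energy_eq {U f : ℝ → ℝ} (hU : IsAdmissible U) (hf : f ∈ unitSphere)
    (he : energy U f = fundamentalMode U) : IsGroundState U f (weakDeriv f) := by
  have h := hf.1.isH1
  by_cases hi : Integrable (fun x => U x * f x ^ 2) halfVolume
  · refine ⟨h, hi, ?_⟩
    rw [HalfLine.energy_eq h hi, ← hU.coe_toReal, EReal.coe_eq_coe_iff] at he
    rw [hf.2, mul_one, he]
  · rw [energy_eq_top hU h hi] at he
    exact absurd he.symm hU.fundamentalMode_ne_top

/-- The bound state below the lower limit of the potential. -/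
theorem exists_groundState_of_lt_liminf {U : ℝ → ℝ} (hU : IsPotential U)
    (hlt : fundamentalMode U < liminf (fun ξ => (U ξ : EReal)) essAtTop) :
    ∃ ψ : ℝ → ℝ, ψ ∈ unitSphere ∧ (∀ ξ : ℝ, 0 < ξ → 0 < ψ ξ) ∧
      energy U ψ = fundamentalMode U ∧
      (∀ φ : ℝ → ℝ, φ ∈ unitSphere → (∀ ξ : ℝ, 0 < ξ → 0 ≤ φ ξ) →
        energy U φ = fundamentalMode U → EqOn φ ψ (Ici 0)) ∧
      ∀ W : ℝ → ℝ, IsBoundedCompact W →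
        HasGateauxDeriv fundamentalMode U W (∫ ξ in Ioi 0, ψ ξ ^ 2 * W ξ) := by
  have hA := hU.isAdmissible
  obtain ⟨c, hc, hcl⟩ := EReal.lt_iff_exists_real_btwn.1 hlt
  rw [← hA.coe_toReal, EReal.coe_lt_coe_iff] at hc
  obtain ⟨R, hR⟩ := exists_ae_of_eventually_essAtTop (eventually_lt_of_lt_liminf hcl)
  replace hR : ∀ᵐ x ∂halfVolume, R ≤ x → c ≤ U x := by
    filter_upwards [hR] with x hx hxR
    exact_mod_cast (hx hxR).le
  have habs : ∀ f g : ℝ → ℝ, IsGroundState U f g → ∫ x in Ioi 0, f x ^ 2 = 1 →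
      ∃ g', IsGroundState U (fun x => |f x|) g' ∧ ∫ x in Ioi 0, |f x| ^ 2 = 1 := by
    intro f g h h1
    obtain ⟨g', h'⟩ := h.abs
    exact ⟨g', h', by simpa only [sq_abs] using h1⟩
  obtain ⟨F, G, hFG⟩ := hA.exists_isMinimizingSeq
  obtain ⟨f, g, hf, hf1, -⟩ := hFG.exists_isGroundState hU hc hR
  obtain ⟨g', hψ, hψ1⟩ := habs f g hf hf1
  set ψ : ℝ → ℝ := fun x => |f x|
  have hψ0 : ∀ x, 0 < x → 0 ≤ ψ x := fun x _ => abs_nonneg _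
  refine ⟨ψ, hψ.toIsH1.mem_unitSphere hψ1, ?_, hψ.energy_eq hA hψ1, ?_, ?_⟩
  · refine (hψ.eq_zero_or_pos hA hψ0).resolve_left fun h0 => ?_
    have : ∫ x in Ioi 0, ψ x ^ 2 = 0 := integral_eq_zero_of_ae
      (ae_halfVolume_of_ae fun x hx => by simp [h0 x hx])
    rw [this] at hψ1
    exact zero_ne_one hψ1
  · intro φ hφ hφ0 he
    exact (isGroundState_of_energy_eq hA hφ he).eqOn_of_nonneg hA hψ hφ.2 hψ1 hφ0 hψ0
  · intro W hW
    have hcomm : ∫ ξ in Ioi 0, ψ ξ ^ 2 * W ξ = ∫ ξ in Ioi 0, W ξ * ψ ξ ^ 2 := by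
      simp_rw [mul_comm]
    rw [hcomm]
    refine hasGateauxDeriv_of_isMinimizingSeq hU hW (fun F G hFG => ?_) fun t => ?_
    -- The subsequence may produce a different ground state, but uniqueness identifies its absolute
    -- value with `ψ`, and only the square enters.
    · obtain ⟨u, v, hu, hu1, ms, hms, hlim⟩ := hFG.exists_isGroundState hU hc hR
      obtain ⟨v', hu', hu1'⟩ := habs u v hu hu1
      have heq := hu'.eqOn_of_nonneg hA hψ hu1' hψ1 (fun x _ => abs_nonneg _) hψ0
      have : ∫ x in Ioi 0, W x * u x ^ 2 = ∫ x in Ioi 0, W x * ψ x ^ 2 :=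
        integral_congr_ae (ae_halfVolume_of_ae fun x hx => by
          simp only
          rw [← heq hx.le, sq_abs])
      exact ⟨ms, hms, this ▸ hlim W hW.integrable⟩
    · obtain ⟨C, hC⟩ := hW.bounded
      have i1 := (integrable_mul_sq_of_bounded hW.aestronglyMeasurable hC
        hψ.integrable_sq).const_mul t
      have e : ∀ x, (U x + t * W x) * ψ x ^ 2 = U x * ψ x ^ 2 + t * (W x * ψ x ^ 2) :=
        fun x => by ring
      have hi : Integrable (fun x => (U x + t * W x) * ψ x ^ 2) halfVolume := by
        simp_rw [e]; exact hψ.integrable.add i1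
      -- The linear upper bound comes from using the unperturbed ground state as a test function.
      have k := (hA.add_mul hW t).toReal_le hψ.toIsH1 hψ1 hi
      simp_rw [e] at k
      rw [integral_add hψ.integrable i1, integral_const_mul] at k
      have k2 := hψ.energy_le
      rw [hψ1, mul_one] at k2
      linarith

/-- The derivative vanishes when the fundamental mode equals the limit of the potential. -/
theorem hasGateauxDeriv_zero_of_tendsto {U : ℝ → ℝ} {l : EReal} (hU : IsPotential U)
    (hl : Tendsto (fun ξ => (U ξ : EReal)) essAtTop (𝓝 l))
    (hle : ∀ᵐ ξ ∂halfVolume, (U ξ : EReal) ≤ l) (he : fundamentalMode U = l) {W : ℝ → ℝ}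
    (hW : IsBoundedCompact W) : HasGateauxDeriv fundamentalMode U W 0 := by
  have hA := hU.isAdmissible
  rw [← he, ← hA.coe_toReal] at hl hle
  set E := (fundamentalMode U).toReal with hE
  have hle' : ∀ᵐ ξ ∂halfVolume, U ξ ≤ E := by
    filter_upwards [hle] with x hx
    exact_mod_cast hx
  refine hasGateauxDeriv_of_isMinimizingSeq hU hW (fun F G hFG => ?_) fun t => ?_
  · obtain ⟨ms, hms, hlim⟩ := hFG.exists_tendsto_zero hU hle' fun ε hε => by
      have hlt : ((E - ε : ℝ) : EReal) < E := EReal.coe_lt_coe_iff.2 (by linarith)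
      obtain ⟨R, hR⟩ := exists_ae_of_eventually_essAtTop (hl.eventually (lt_mem_nhds hlt))
      refine ⟨R, ?_⟩
      filter_upwards [hR] with x hx hxR
      exact_mod_cast (hx hxR).le
    exact ⟨ms, hms, hlim W hW.integrable⟩
  · rw [mul_zero, add_zero]
    obtain ⟨R, hR⟩ := hW.compact_support
    -- Far tents do not see `W`, so the perturbed mode never exceeds `E`. The shift to `R + 1` is
    -- needed because `W` vanishes only strictly beyond `R`.
    refine (hA.add_mul hW t).toReal_le_of_eventually (R := R + 1) ?_
    filter_upwards [hle', hR] with x hx hx' hxR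
    rw [hx' (by linarith), mul_zero, add_zero]
    exact hx

end HalfLine

end

/-- Properties of the fundamental mode on the half-line: (1) finiteness, continuity, concavity,
monotonicity and the bound by the upper limit of the potential; (2) the bound state case;
(3) the case of equality with the limit of the potential; (4) scaling. -/
theorem proposition3p1 :
    ((∀ U : ℝ → ℝ, HalfLine.IsPotential U →
        0 ≤ HalfLine.fundamentalMode U ∧ HalfLine.fundamentalMode U ≠ ⊤) ∧
      (∀ U : ℝ → ℝ, HalfLine.IsPotential U → ∀ ε : ℝ, 0 < ε →
        ∃ δ : ℝ, 0 < δ ∧ ∀ V : ℝ → ℝ, HalfLine.IsPotential V →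
          HalfLine.ulocDist V U ≤ ENNReal.ofReal δ →
            |(HalfLine.fundamentalMode V).toReal - (HalfLine.fundamentalMode U).toReal| ≤ ε) ∧
      ConcaveOn ℝ {U : ℝ → ℝ | HalfLine.IsPotential U}
        (fun U => (HalfLine.fundamentalMode U).toReal) ∧
      (∀ U V : ℝ → ℝ, HalfLine.IsPotential U → HalfLine.IsPotential V →
        (∀ᵐ ξ ∂HalfLine.halfVolume, U ξ ≤ V ξ) →
          HalfLine.fundamentalMode U ≤ HalfLine.fundamentalMode V) ∧
      (∀ U : ℝ → ℝ, HalfLine.IsPotential U →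
        HalfLine.fundamentalMode U ≤ limsup (fun ξ => (U ξ : EReal)) HalfLine.essAtTop)) ∧
    (∀ U : ℝ → ℝ, HalfLine.IsPotential U →
      HalfLine.fundamentalMode U < liminf (fun ξ => (U ξ : EReal)) HalfLine.essAtTop →
        ∃ ψ : ℝ → ℝ, ψ ∈ HalfLine.unitSphere ∧ (∀ ξ : ℝ, 0 < ξ → 0 < ψ ξ) ∧
          HalfLine.energy U ψ = HalfLine.fundamentalMode U ∧
          (∀ φ : ℝ → ℝ, φ ∈ HalfLine.unitSphere → (∀ ξ : ℝ, 0 < ξ → 0 ≤ φ ξ) →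
            HalfLine.energy U φ = HalfLine.fundamentalMode U → EqOn φ ψ (Ici 0)) ∧
          ∀ W : ℝ → ℝ, HalfLine.IsBoundedCompact W →
            HalfLine.HasGateauxDeriv HalfLine.fundamentalMode U W
              (∫ ξ in Ioi 0, ψ ξ ^ 2 * W ξ)) ∧
    (∀ (U : ℝ → ℝ) (l : EReal), HalfLine.IsPotential U →
      Tendsto (fun ξ => (U ξ : EReal)) HalfLine.essAtTop (𝓝 l) →
      (∀ᵐ ξ ∂HalfLine.halfVolume, (U ξ : EReal) ≤ l) →
      HalfLine.fundamentalMode U = l →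
        ∀ W : ℝ → ℝ, HalfLine.IsBoundedCompact W →
          HalfLine.HasGateauxDeriv HalfLine.fundamentalMode U W 0) ∧
    (∀ α : ℝ, 0 < α →
      HalfLine.fundamentalMode (fun ξ => α * √ξ) =
        ((α ^ (4 / 5 : ℝ) : ℝ) : EReal) * HalfLine.fundamentalMode (fun ξ => √ξ)) := by
  refine ⟨⟨fun U hU => ?_, fun U hU ε hε => hU.exists_ulocDist_bound hε,
    HalfLine.concaveOn_fundamentalMode, fun U V hU hV h => HalfLine.fundamentalMode_mono hU hV h,
    fun U hU => HalfLine.fundamentalMode_le_limsup hU.isAdmissible⟩,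
    fun U hU h => HalfLine.exists_groundState_of_lt_liminf hU h,
    fun U l hU hl hle he W hW => HalfLine.hasGateauxDeriv_zero_of_tendsto hU hl hle he hW,
    fun α hα => HalfLine.fundamentalMode_mul_sqrt hα⟩
  refine ⟨?_, hU.isAdmissible.fundamentalMode_ne_top⟩
  rw [← hU.isAdmissible.coe_toReal]
  exact_mod_cast hU.toReal_nonneg
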